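/- Let $d\in\mathbb N$ and let $u:\mathbb Z^d\to\mathbb R$ satisfy $|u(k)|\le C\mathrm e^{-\alpha\|k\|_1}$ for all $k\in\mathbb Z^d$, with constants $C,\alpha>0$. Let $F(z)=\sum_{k\in\mathbb Z^d}u(-k)z^k$ (defined for $z\in\mathbb C^d$ near $\mathbf 1=(1,\dots,1)$), and let $I_0\in\mathbb N_0^d$ be a multi-index with $(D_z^{I_0}F)(\mathbf 1)\neq 0$ and $(D_z^{I}F)(\mathbf 1)=0$ for all $I\in\mathbb N_0^d$ with $I\le I_0$ componentwise and $I\ne I_0$. Let $\mu$ be a probability measure on $\mathbb R$ with bounded support and with a density $\rho\in\mathrm{BV}(\mathbb R)$, that is, $\rho\in L^1(\mathbb R)$ and the distributional derivative of $\rho$ is a finite signed Borel measure. Let $\Omega=(\operatorname{supp}\mu)^{\mathbb Z^d}$ and $\mathbb P=\bigotimes_{k\in\mathbb Z^d}\mu$. For $\omega\in\Omega$ let $h_\omega=h_0+v_\omega$ on $\ell^2(\mathbb Z^d)$, where $(h_0\psi)(x)=\sum_{\|x-y\|_1=1}(\psi(x)-\psi(y))$ and $v_\omega$ is multiplication by $v_\omega(x)=\sum_{k\in\mathbb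 Z^d}\omega_k u(x-k)$. For a finite set $\Lambda\subset\mathbb Z^d$ let $h_\omega^{\Lambda}=\pi_\Lambda h_\omega\iota_\Lambda$ on $\ell^2(\Lambda)$, where $\iota_\Lambda$ is the extension by zero and $\pi_\Lambda$ the restriction to $\Lambda$. Write $\Lambda_l(j)=([-l,l]^d+j)\cap\mathbb Z^d$. For $x,y\in\mathbb Z^d$ and real $l_1,l_2>0$ put $\mathfrak C_1=\Lambda_{l_1}(x)$, $\mathfrak C_1^+=\Lambda_{4l_1}(x)$, $\mathfrak C_2=\Lambda_{l_2}(y)$, $\mathfrak C_2^+=\Lambda_{4l_2}(y)$, and for $\omega\in\Omega$ define the uniform distance $$\tilde d\bigl(\sigma(h_\omega^{\mathfrak C_1}),\sigma(h_\omega^{\mathfrak C_2})\bigr)=\inf_{\omega_1^\perp,\ \omega_2^\perp} d\Bigl(\sigma\bigl(h^{\mathfrak C_1}_{(\omega_1,\omega_1^\perp)}\bigr),\sigma\bigl(h^{\mathfrak C_2}_{(\omega_2,\omega_2^\perp)}\bigr)\Bigr),$$ where $d(A,B)=\inf\{|a-b|:a\in A,\ b\in B\}$, $\omega_i$ is the restriction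 of $\omega$ to $\mathfrak C_i^+$, $(\omega_i,\omega_i^\perp)$ is the configuration equal to $\omega_i$ on $\mathfrak C_i^+$ and to $\omega_i^\perp$ off $\mathfrak C_i^+$, and $\omega_i^\perp$ runs, independently for $i=1,2$, over $(\operatorname{supp}\mu)^{\mathbb Z^d\setminus\mathfrak C_i^+}$. Then there are constants $l_0$, depending only on $u$ (including $C$, $\alpha$ and the choice of $I_0$), and $C_1>0$ and $C_2$, depending only on these data and on $\rho$, such that for all $x,y\in\mathbb Z^d$ and all $l_1,l_2>0$ with $\mathfrak C_1^+\cap\mathfrak C_2^+=\emptyset$ and $l_2\ge l_0$, and for all $\epsilon>0$, $$\mathbb P\Bigl(\Bigl\{\omega\in\Omega:\tilde d\bigl(\sigma(h_\omega^{\mathfrak C_1}),\sigma(h_\omega^{\mathfrak C_2})\bigr)<\epsilon\Bigr\}\Bigr)\le C_1\bigl(2\max\{l_1,l_2\}+1\bigr)^{3d+\|I_0\|_1}\Bigl[\epsilon+C_2\,\mathrm e^{-3\min\{l_1,l_2\}\alpha/2}\Bigr].$$ -/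

import Mathlib

open MeasureTheory
open scoped ENNReal

noncomputable section

namespace AlloyType

/-- The lattice `ℤ^d`. -/
abbrev Site (d : ℕ) : Type := Fin d → ℤ

/-- The norm `‖k‖₁` on `ℤ^d`. -/
def norm1 {d : ℕ} (k : Site d) : ℤ := ∑ r, |k r|

/-- The cube `([-l, l]^d + j) ∩ ℤ^d`. -/
def cube {d : ℕ} (l : ℝ) (j : Site d) : Set (Site d) :=
  {k | ∀ r, |(k r : ℝ) - (j r : ℝ)| ≤ l}

/-! ### The single-site potential, its generating function and the multi-index `I₀` -/

/-- Exponential decay `|u k| ≤ C exp (-α ‖k‖₁)` with `C, α > 0`. -/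
def ExpDecay {d : ℕ} (u : Site d → ℝ) (C α : ℝ) : Prop :=
  0 < C ∧ 0 < α ∧ ∀ k, |u k| ≤ C * Real.exp (-α * (norm1 k : ℝ))

/-- The generating function `F z = ∑ₖ u (-k) z^k`, where `z^k = ∏ᵣ zᵣ ^ kᵣ`. For exponentially
decaying `u` the series converges absolutely in a neighbourhood of `(1, …, 1)`. -/
def genFun {d : ℕ} (u : Site d → ℝ) (z : Fin d → ℂ) : ℂ :=
  ∑' k : Site d, (u (-k) : ℂ) * ∏ r, z r ^ k r

/-- The partial derivative `∂/∂zᵣ`. -/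
def partialDeriv {d : ℕ} (r : Fin d) (G : (Fin d → ℂ) → ℂ) : (Fin d → ℂ) → ℂ :=
  fun z => deriv (fun t : ℂ => G (Function.update z r t)) (z r)

/-- The iterated partial derivative `∂₁^{I₁} ∂₂^{I₂} ⋯ ∂_d^{I_d}`. -/
def multiDeriv {d : ℕ} (I : Fin d → ℕ) (G : (Fin d → ℂ) → ℂ) : (Fin d → ℂ) → ℂ :=
  (List.finRange d).foldr (fun r H => (partialDeriv r)^[I r] H) G

/-- `(D^I F)(1, …, 1)` is nonzero for `I = I₀` and zero for all multi-indices `I < I₀`, where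
`I < I₀` means that `I ≤ I₀` componentwise and `I ≠ I₀`. -/
def IsLeadingIndex {d : ℕ} (u : Site d → ℝ) (I₀ : Fin d → ℕ) : Prop :=
  multiDeriv I₀ (genFun u) 1 ≠ 0 ∧ ∀ I : Fin d → ℕ, I < I₀ → multiDeriv I (genFun u) 1 = 0

/-! ### The distribution of the coupling constants -/

/-- `ρ ∈ BV(ℝ)`: `ρ` is integrable and its distributional derivative is a (finite) signed Borel
measure `ν`, that is `∫ φ dν = - ∫ ρ φ'` for all test functions `φ`. The integral with respect to
`ν` is written out through its Jordan decomposition. -/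
def IsBV (ρ : ℝ → ℝ) : Prop :=
  Integrable ρ ∧
    ∃ ν : SignedMeasure ℝ, ∀ φ : ℝ → ℝ, ContDiff ℝ (⊤ : ℕ∞) φ → HasCompactSupport φ →
      ∫ t, φ t ∂ν.toJordanDecomposition.posPart - ∫ t, φ t ∂ν.toJordanDecomposition.negPart
        = -∫ t, ρ t * deriv φ t

/-- `ρ` is a density of `μ` with respect to Lebesgue measure. -/
def IsDensity (μ : Measure ℝ) (ρ : ℝ → ℝ) : Prop :=
  (∀ᵐ t, 0 ≤ ρ t) ∧ μ = volume.withDensity (fun t => ENNReal.ofReal (ρ t))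

/-- The space `Ω_Γ` of configurations `(ω_k)_{k ∈ Γ}` with all `ω_k` in the support of `μ`. -/
def confOn {d : ℕ} (μ : Measure ℝ) (Γ : Set (Site d)) : Set (Γ → ℝ) :=
  {ω | ∀ k, ω k ∈ μ.support}

/-- The space `Ω` of configurations `(ω_k)_{k ∈ ℤ^d}` with all `ω_k` in the support of `μ`. -/
def conf (d : ℕ) (μ : Measure ℝ) : Set (Site d → ℝ) :=
  {ω | ∀ k, ω k ∈ μ.support}

/-- The product measure `ℙ = ⨂_{k ∈ ℤ^d} μ`, as a measure on `ℝ^{ℤ^d}` (it is carried by `Ω`). -/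
def prodMeasure (d : ℕ) (μ : Measure ℝ) [IsProbabilityMeasure μ] : Measure (Site d → ℝ) :=
  Measure.infinitePi (fun _ : Site d => μ)

/-! ### The operators -/

/-- The sites `y` with `‖x - y‖₁ = 1`; they all lie in the box `[x - 1, x + 1]`. -/
def neighbors {d : ℕ} (x : Site d) : Finset (Site d) :=
  (Finset.Icc (x - 1) (x + 1)).filter (fun y => norm1 (x - y) = 1)

/-- The negative discrete Laplacian, `(h₀ ψ) x = ∑_{‖x - y‖₁ = 1} (ψ x - ψ y)`. -/
def freeOp (d : ℕ) : (Site d → ℂ) →ₗ[ℂ] (Site d → ℂ) where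
  toFun ψ x := ∑ y ∈ neighbors x, (ψ x - ψ y)
  map_add' ψ φ := by
    funext x
    simp only [Pi.add_apply, ← Finset.sum_add_distrib]
    exact Finset.sum_congr rfl fun y _ => by ring
  map_smul' c ψ := by
    funext x
    simp only [Pi.smul_apply, smul_eq_mul, RingHom.id_apply, Finset.mul_sum]
    exact Finset.sum_congr rfl fun y _ => by ring

/-- The potential `v_ω x = ∑ₖ ω_k u (x - k)`. -/
def potential {d : ℕ} (u : Site d → ℝ) (ω : Site d → ℝ) (x : Site d) : ℝ :=
  ∑' k : Site d, ω k * u (x - k)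

/-- The multiplication operator by `v_ω`. -/
def potentialOp {d : ℕ} (u : Site d → ℝ) (ω : Site d → ℝ) :
    (Site d → ℂ) →ₗ[ℂ] (Site d → ℂ) where
  toFun ψ x := (potential u ω x : ℂ) * ψ x
  map_add' ψ φ := by
    funext x
    simp only [Pi.add_apply, mul_add]
  map_smul' c ψ := by
    funext x
    simp only [Pi.smul_apply, smul_eq_mul, RingHom.id_apply]
    ring

/-- The compression `π_Λ T ι_Λ` of an operator to `Λ`: extend by zero, apply `T`, restrict. -/
def compress {d : ℕ} (Λ : Set (Site d)) (T : (Site d → ℂ) →ₗ[ℂ] (Site d → ℂ)) :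
    Module.End ℂ (Λ → ℂ) :=
  LinearMap.funLeft ℂ ℂ (Subtype.val : Λ → Site d) ∘ₗ T ∘ₗ
    Function.ExtendByZero.linearMap ℂ (Subtype.val : Λ → Site d)

/-- The restriction `h_ω^Λ = π_Λ h₀ ι_Λ + π_Λ v_ω ι_Λ`. For finite `Λ` the space `Λ → ℂ` is
`ℓ²(Λ)` as a vector space, and only the spectrum of the operator is used. -/
def boxOp {d : ℕ} (u : Site d → ℝ) (Λ : Set (Site d)) (ω : Site d → ℝ) :
    Module.End ℂ (Λ → ℂ) :=
  compress Λ (freeOp d) + compress Λ (potentialOp u ω)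

/-! ### The uniform distance of two spectra -/

/-- The distance `d(A, B) = inf {|a - b| : a ∈ A, b ∈ B}` of two sets. -/
def setDist (A B : Set ℂ) : ℝ≥0∞ := ⨅ a ∈ A, ⨅ b ∈ B, edist a b

open Classical in
/-- The configuration `(ω, ω^⊥)` made of `ω` on `Γ` and `ω^⊥` on the complement of `Γ`. -/
def glue {d : ℕ} (Γ : Set (Site d)) (ω : Γ → ℝ) (ω' : (Γᶜ : Set (Site d)) → ℝ) : Site d → ℝ :=
  fun k => if h : k ∈ Γ then ω ⟨k, h⟩ else ω' ⟨k, h⟩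

/-- The uniform distance of the spectra of `h_ω^{Λ₁}` and `h_ω^{Λ₂}`: the infimum of the distance
of the spectra when the couplings outside `Γ₁` for the first operator and outside `Γ₂` for the
second one are varied, independently of each other, over the support of `μ`. -/
def unifDist {d : ℕ} (u : Site d → ℝ) (μ : Measure ℝ) (Λ₁ Γ₁ Λ₂ Γ₂ : Set (Site d))
    (ω : Site d → ℝ) : ℝ≥0∞ :=
  ⨅ ω₁ ∈ confOn μ Γ₁ᶜ, ⨅ ω₂ ∈ confOn μ Γ₂ᶜ,
    setDist (spectrum ℂ (boxOp u Λ₁ (glue Γ₁ (Γ₁.domRestrict ω) ω₁)))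
      (spectrum ℂ (boxOp u Λ₂ (glue Γ₂ (Γ₂.domRestrict ω) ω₂)))

/-- The event that the uniform distance of the spectra for the cubes of radii `l₁`, `l₂` around
`x`, `y`, with enlarged cubes of radii `4 l₁`, `4 l₂`, is less than `ε`. -/
def resonanceEvent {d : ℕ} (u : Site d → ℝ) (μ : Measure ℝ) (x y : Site d) (l₁ l₂ ε : ℝ) :
    Set (Site d → ℝ) :=
  {ω | ω ∈ conf d μ ∧
    unifDist u μ (cube l₁ x) (cube (4 * l₁) x) (cube l₂ y) (cube (4 * l₂) y) ω
      < ENNReal.ofReal ε}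

end AlloyType

end

/-! A coupling outside the enlarged cube reaches the small cube only through the tail of `u`.
Replacing the spectra by the eigenvalues `cubeEig`, which see only the couplings in the enlarged
cube, therefore costs an exponentially small error and removes the infimum over exterior
configurations (`ExpDecay.exists_of_mem_resonanceEvent`). It remains to bound the probability that
some eigenvalue `E i` of the first cube and some `lam j` of the second are `ε`-close.

Since `u` may change sign, the `lam j` need not be monotone in single couplings. By Vandermonde's
identity and the vanishing of the lower moments, however, the translates of `u` with binomial
coefficients of order `I₀` as weights add up to a nonzero constant
(`IsLeadingIndex.hasSum_weight_add`). Truncated to a large enlarged cube, the sum still has a fixed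
sign and at least half that size on the small cube (`IsLeadingIndex.exists_half_le`). Hence an
explicit shift of the couplings of the second cube raises every `lam j` by `2 * ε`, by the min-max
comparison `eigenvalues_add_le`, and fixes every `E i` by disjointness.

Let `G` count the pairs with `lam j < E i + ε`. The shift never increases `G`, and lowers it by at
least one on the resonance event, whose probability is thus at most the change of the mean of `G`
(`prodMeasure_close_le`). A BV density makes this change at most the bound on `G` times the
variation times the total size of the shift (`lintegral_prodMeasure_le_sum`), which is linear in `ε`
and polynomial in the radii. -/

/-! ### Comparison of ordered eigenvalues -/

namespace LinearMap.IsSymmetric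

variable {𝕜 E : Type*} [RCLike 𝕜] [NormedAddCommGroup E] [InnerProductSpace 𝕜 E]
  [FiniteDimensional 𝕜 E] {S T : E →ₗ[𝕜] E} {n : ℕ}

/-- The quadratic form of a symmetric operator in terms of its eigenvalues. -/
lemma re_inner_apply_self_eq_sum (hS : S.IsSymmetric) (hn : Module.finrank 𝕜 E = n) (v : E) :
    RCLike.re (inner 𝕜 (S v) v) =
      ∑ j, hS.eigenvalues hn j * ‖inner 𝕜 (hS.eigenvectorBasis hn j) v‖ ^ 2 := by
  rw [← (hS.eigenvectorBasis hn).sum_inner_mul_inner, map_sum]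
  refine Finset.sum_congr rfl fun j _ => ?_
  rw [hS v, hS.apply_eigenvectorBasis, inner_smul_right, mul_assoc,
    ← inner_conj_symm v, RCLike.conj_mul]
  norm_cast

/-- If `S + t ≤ T` in the sense of quadratic forms, then the ordered eigenvalues satisfy
`λᵢ(S) + t ≤ λᵢ(T)`. -/
theorem eigenvalues_add_le (hS : S.IsSymmetric) (hT : T.IsSymmetric)
    (hn : Module.finrank 𝕜 E = n) {t : ℝ}
    (h : ∀ v, RCLike.re (inner 𝕜 (S v) v) + t * ‖v‖ ^ 2 ≤ RCLike.re (inner 𝕜 (T v) v))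
    (i : Fin n) : hS.eigenvalues hn i + t ≤ hT.eigenvalues hn i := by
  let b := hS.eigenvectorBasis hn
  let c := hT.eigenvectorBasis hn
  -- Only `n - 1` conditions are imposed, so the kernel is nontrivial. The eigenvalues decrease, so
  -- a vector spanned by the `b j` with `j ≤ i` and also by the `c j` with `i ≤ j` bounds the form
  -- of `S` below by its `i`-th eigenvalue and that of `T` above.
  let f : E →ₗ[𝕜] ({j : Fin n // j ≠ i} → 𝕜) :=
    LinearMap.pi fun j => if i < j.1 then (innerSL 𝕜 (b j)).toLinearMap
      else (innerSL 𝕜 (c j)).toLinearMap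
  have hf : LinearMap.ker f ≠ ⊥ := by
    apply LinearMap.ker_ne_bot_of_finrank_lt
    rw [hn, Module.finrank_fintype_fun_eq_card, Fintype.card_subtype_compl, Fintype.card_fin]
    simp
    exact i.pos
  obtain ⟨v, hv, hv0⟩ := (Submodule.ne_bot_iff _).1 hf
  have hbv : ∀ j, i < j → inner 𝕜 (b j) v = 0 := fun j hj => by
    have := congrFun (LinearMap.mem_ker.1 hv) ⟨j, hj.ne'⟩
    simpa [f, hj] using this
  have hcv : ∀ j, j < i → inner 𝕜 (c j) v = 0 := fun j hj => by
    have := congrFun (LinearMap.mem_ker.1 hv) ⟨j, hj.ne⟩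
    simpa [f, hj.not_gt] using this
  have h1 : hS.eigenvalues hn i * ‖v‖ ^ 2 ≤ RCLike.re (inner 𝕜 (S v) v) := by
    rw [hS.re_inner_apply_self_eq_sum hn, ← b.sum_sq_norm_inner_right, Finset.mul_sum]
    refine Finset.sum_le_sum fun j _ => ?_
    rcases le_or_gt j i with hj | hj
    · exact mul_le_mul_of_nonneg_right (hS.eigenvalues_antitone hn hj) (by positivity)
    · have := hbv j hj
      simp only [b] at this ⊢
      simp [this]
  have h2 : RCLike.re (inner 𝕜 (T v) v) ≤ hT.eigenvalues hn i * ‖v‖ ^ 2 := by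
    rw [hT.re_inner_apply_self_eq_sum hn, ← c.sum_sq_norm_inner_right, Finset.mul_sum]
    refine Finset.sum_le_sum fun j _ => ?_
    rcases le_or_gt i j with hj | hj
    · exact mul_le_mul_of_nonneg_right (hT.eigenvalues_antitone hn hj) (by positivity)
    · have := hcv j hj
      simp only [c] at this ⊢
      simp [this]
  have hpos : 0 < ‖v‖ ^ 2 := by positivity
  have := h v
  exact le_of_mul_le_mul_right (by linarith) hpos

end LinearMap.IsSymmetric

namespace AlloyType

/-! ### Eigenvalues of the restricted operators -/

lemma norm1_neg {d : ℕ} (k : Site d) : norm1 (-k) = norm1 k := by simp [norm1]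

lemma mem_neighbors {d : ℕ} {x y : Site d} : y ∈ neighbors x ↔ norm1 (x - y) = 1 := by
  simp only [neighbors, Finset.mem_filter, Finset.mem_Icc, and_iff_right_iff_imp]
  intro h
  have : ∀ r, |x r - y r| ≤ 1 := fun r => by
    rw [← h]
    exact Finset.single_le_sum (f := fun r => |(x - y) r|) (fun _ _ => abs_nonneg _)
      (Finset.mem_univ r)
  constructor <;> intro r <;> have := abs_le.1 (this r) <;> simp <;> lia

lemma mem_neighbors_comm {d : ℕ} {x y : Site d} : y ∈ neighbors x ↔ x ∈ neighbors y := by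
  rw [mem_neighbors, mem_neighbors, ← norm1_neg, neg_sub]

open Classical in
lemma extendByZero_single {d : ℕ} (Λ : Set (Site d)) (y : Λ) :
    Function.ExtendByZero.linearMap ℂ (Subtype.val : Λ → Site d) (Pi.single y 1) =
      Pi.single (y : Site d) 1 := by
  funext z
  by_cases hz : z ∈ Λ
  · have := Subtype.val_injective.extend_apply (Pi.single y (1 : ℂ)) 0 (⟨z, hz⟩ : Λ)
    simp only [Function.ExtendByZero.linearMap_apply]
    rw [this]
    simp [Pi.single_apply, Subtype.ext_iff]
  · simp only [Function.ExtendByZero.linearMap_apply]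
    rw [Function.extend_apply', Pi.single_eq_of_ne]
    · rfl
    · rintro rfl; exact hz y.2
    · rintro ⟨a, rfl⟩; exact hz a.2

section Box

variable {d : ℕ} (Λ : Set (Site d)) [Fintype Λ]

open Classical in
/-- The matrix of the restriction of the free operator to `Λ`. -/
noncomputable def freeMatrix : Matrix Λ Λ ℂ := LinearMap.toMatrix' (compress Λ (freeOp d))

open Classical in
lemma freeMatrix_apply (x y : Λ) :
    freeMatrix Λ x y = (if x = y then ((neighbors (x : Site d)).card : ℂ) else 0)
      - if (y : Site d) ∈ neighbors (x : Site d) then 1 else 0 := by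
  rw [freeMatrix, LinearMap.toMatrix'_apply]
  have h2 : compress Λ (freeOp d) (Pi.single y 1) x =
      freeOp d (Pi.single (y : Site d) 1) x := by
    simp only [compress, LinearMap.comp_apply, extendByZero_single]
    rfl
  rw [h2]
  simp [freeOp, Finset.sum_sub_distrib, Pi.single_apply, Subtype.ext_iff]

/-- The matrix of the restriction to `Λ` of the free operator plus the potential `v`. -/
noncomputable def boxMatrix [DecidableEq Λ] (v : Λ → ℝ) : Matrix Λ Λ ℂ :=
  freeMatrix Λ + Matrix.diagonal fun x => (v x : ℂ)

lemma isHermitian_boxMatrix [DecidableEq Λ] (v : Λ → ℝ) : (boxMatrix Λ v).IsHermitian := by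
  refine Matrix.IsHermitian.add ?_ (Matrix.isHermitian_diagonal_of_self_adjoint _ ?_)
  · ext x y
    rw [Matrix.conjTranspose_apply, freeMatrix_apply, freeMatrix_apply]
    simp only [mem_neighbors_comm (x := (y : Site d))]
    rcases eq_or_ne x y with rfl | h
    · by_cases hx : (x : Site d) ∈ neighbors (x : Site d) <;> simp [hx]
    · simp [h, h.symm, apply_ite]
  · ext x
    simp

/-- The decreasingly ordered eigenvalues of the free operator on `Λ` plus the potential `v`. -/
noncomputable def eig [DecidableEq Λ] (v : Λ → ℝ) : Fin (Fintype.card Λ) → ℝ :=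
  (isHermitian_boxMatrix Λ v).eigenvalues₀

/-- The free parts of the two quadratic forms cancel, and the potentials act diagonally, so the
pointwise inequality is a form inequality. -/
lemma eig_add_le [DecidableEq Λ] {v w : Λ → ℝ} {t : ℝ} (h : ∀ x, v x + t ≤ w x)
    (i : Fin (Fintype.card Λ)) : eig Λ v i + t ≤ eig Λ w i := by
  refine LinearMap.IsSymmetric.eigenvalues_add_le _ _ _ (fun f => ?_) i
  have key : ∀ v : Λ → ℝ,
      RCLike.re (inner ℂ (Matrix.toEuclideanLin (boxMatrix Λ v) f) f) =
      RCLike.re (inner ℂ (Matrix.toEuclideanLin (freeMatrix Λ) f) f) + ∑ x, v x * ‖f x‖ ^ 2 := by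
    intro v
    rw [boxMatrix, map_add, LinearMap.add_apply, inner_add_left, map_add]
    congr 1
    rw [PiLp.inner_apply, map_sum]
    refine Finset.sum_congr rfl fun x _ => ?_
    simp only [Matrix.toLpLin_apply, Matrix.mulVec_diagonal]
    rw [show (v x : ℂ) * f x = (v x : ℂ) • f x from rfl, inner_smul_left,
      inner_self_eq_norm_sq_to_K]
    simp only [RCLike.ofReal_eq_complex_ofReal, Complex.conj_ofReal]
    norm_cast
  rw [key, key, EuclideanSpace.norm_sq_eq, Finset.mul_sum, add_assoc, ← Finset.sum_add_distrib]
  gcongr with x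
  rw [← add_mul]
  exact mul_le_mul_of_nonneg_right (h x) (by positivity)

lemma abs_eig_sub_le [DecidableEq Λ] {v w : Λ → ℝ} {t : ℝ} (h : ∀ x, |v x - w x| ≤ t)
    (i : Fin (Fintype.card Λ)) : |eig Λ v i - eig Λ w i| ≤ t := by
  have h1 := eig_add_le Λ (v := v) (w := w) (t := -t)
    (fun x => by have := abs_le.1 (h x); linarith) i
  have h2 := eig_add_le Λ (v := w) (w := v) (t := -t)
    (fun x => by have := abs_le.1 (h x); linarith) i
  rw [abs_le]; constructor <;> linarith

lemma continuous_eig [DecidableEq Λ] (i : Fin (Fintype.card Λ)) :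
    Continuous fun v : Λ → ℝ => eig Λ v i := by
  refine (LipschitzWith.of_dist_le_mul (K := 1) fun v w => ?_).continuous
  rw [NNReal.coe_one, one_mul, Real.dist_eq]
  exact abs_eig_sub_le Λ (fun x => by rw [← Real.dist_eq]; exact dist_le_pi_dist v w x) i

lemma toMatrix'_boxOp [DecidableEq Λ] (u ω : Site d → ℝ) :
    LinearMap.toMatrix' (boxOp u Λ ω) = boxMatrix Λ fun x => potential u ω x := by
  have h : LinearMap.toMatrix' (compress Λ (potentialOp u ω)) =
      Matrix.diagonal fun x : Λ => (potential u ω x : ℂ) := by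
    apply Matrix.toLin'.injective
    rw [Matrix.toLin'_toMatrix']
    ext1 y
    ext x
    simp only [compress, LinearMap.comp_apply, Matrix.toLin'_apply,
      LinearMap.funLeft_apply, potentialOp, LinearMap.coe_mk, AddHom.coe_mk]
    rw [Matrix.mulVec_diagonal]
    congr 1
    exact Subtype.val_injective.extend_apply _ _ _
  rw [boxOp, map_add, h, boxMatrix, freeMatrix]
  congr!

/-- An inclusion suffices, because the resonance event only has to be bounded from above. -/
lemma spectrum_boxOp_subset [DecidableEq Λ] (u ω : Site d → ℝ) :
    spectrum ℂ (boxOp u Λ ω) ⊆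
      Set.range fun i => ((eig Λ (fun x => potential u ω x) i : ℝ) : ℂ) := by
  rw [← AlgEquiv.spectrum_eq LinearMap.toMatrixAlgEquiv',
    show LinearMap.toMatrixAlgEquiv' (boxOp u Λ ω) = _ from toMatrix'_boxOp Λ u ω,
    (isHermitian_boxMatrix Λ _).spectrum_eq_image_range]
  rintro _ ⟨_, ⟨i, rfl⟩, rfl⟩
  exact ⟨_, rfl⟩

end Box

end AlloyType

/-! ### Translates of functions of bounded variation -/

namespace AlloyType

open Filter Topology

/-- `V` bounds the total variation of the distributional derivative of `ρ`. -/
def VariationBound (ρ : ℝ → ℝ) (V : ℝ) : Prop :=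
  ∀ (φ : ℝ → ℝ) (M : ℝ), ContDiff ℝ (⊤ : ℕ∞) φ → HasCompactSupport φ → (∀ t, |φ t| ≤ M) →
    |∫ t, ρ t * deriv φ t| ≤ M * V

lemma IsBV.exists_variationBound {ρ : ℝ → ℝ} (hρ : IsBV ρ) : ∃ V, 0 ≤ V ∧ VariationBound ρ V := by
  obtain ⟨-, ν, hν⟩ := hρ
  refine ⟨ν.toJordanDecomposition.posPart.real Set.univ +
    ν.toJordanDecomposition.negPart.real Set.univ, by positivity, fun φ M h1 h2 hM => ?_⟩
  rw [← abs_neg, ← hν φ h1 h2, mul_add]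
  refine (abs_sub _ _).trans (add_le_add ?_ ?_) <;>
  · rw [← Real.norm_eq_abs]
    exact norm_integral_le_of_norm_le_const (Eventually.of_forall hM)

/-- The test function is `φ t = ∫ s in t..t + h, g s`: its derivative is the difference in question
and it is bounded by `M * |h|`. A primitive of `g` need not have compact support, but its increment
does. -/
lemma VariationBound.abs_integral_mul_sub_le_of_contDiff {ρ : ℝ → ℝ} {V : ℝ}
    (hρ : VariationBound ρ V) {g : ℝ → ℝ} {M : ℝ} (hg : ContDiff ℝ (⊤ : ℕ∞) g)
    (hc : HasCompactSupport g) (hM : ∀ t, |g t| ≤ M) (h : ℝ) :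
    |∫ t, ρ t * (g (t + h) - g t)| ≤ M * |h| * V := by
  set Φ : ℝ → ℝ := fun t => ∫ s in (0 : ℝ)..t, g s with hΦ
  have hgc : Continuous g := hg.continuous
  have hd : ∀ t, HasDerivAt Φ (g t) t := fun t => hgc.integral_hasStrictDerivAt 0 t |>.hasDerivAt
  have hΦs : ContDiff ℝ (⊤ : ℕ∞) Φ := by
    rw [contDiff_infty_iff_deriv]
    refine ⟨fun t => (hd t).differentiableAt, ?_⟩
    rwa [show deriv Φ = g from funext fun t => (hd t).deriv]
  set φ : ℝ → ℝ := fun t => Φ (t + h) - Φ t with hφ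
  have hφd : ∀ t, HasDerivAt φ (g (t + h) - g t) t := fun t =>
    ((hd (t + h)).comp_add_const t h).sub (hd t)
  have hφi : ∀ t, φ t = ∫ s in t..t + h, g s := fun t =>
    intervalIntegral.integral_interval_sub_left (hgc.intervalIntegrable _ _)
      (hgc.intervalIntegrable _ _)
  have hφs : ContDiff ℝ (⊤ : ℕ∞) φ :=
    (hΦs.comp (contDiff_id.add contDiff_const)).sub hΦs
  obtain ⟨N, hN⟩ := hc.isCompact.isBounded.subset_closedBall 0
  have hg0 : ∀ t, N < |t| → g t = 0 := fun t ht => by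
    by_contra hne
    have := hN (subset_tsupport g hne)
    rw [mem_closedBall_zero_iff, Real.norm_eq_abs] at this
    linarith
  have hφc : HasCompactSupport φ := by
    refine HasCompactSupport.intro (isCompact_closedBall (0 : ℝ) (N + |h|)) fun t ht => ?_
    rw [mem_closedBall_zero_iff, Real.norm_eq_abs, not_le] at ht
    rw [hφi, intervalIntegral.integral_congr (g := fun _ => 0), intervalIntegral.integral_zero]
    intro s hs
    refine hg0 s ?_
    have h1 : |s - t| ≤ |h| := by
      simpa using Set.abs_sub_left_of_mem_uIcc hs
    have h2 := abs_sub_abs_le_abs_sub t s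
    rw [abs_sub_comm] at h1
    linarith
  have hφM : ∀ t, |φ t| ≤ M * |h| := fun t => by
    rw [hφi, ← Real.norm_eq_abs]
    simpa using intervalIntegral.norm_integral_le_of_norm_le_const (a := t) (b := t + h)
      (f := g) (C := M) (fun s _ => hM s)
  simpa only [fun t => (hφd t).deriv] using hρ φ _ hφs hφc hφM

/-- Passing to the limit in a bound for `∫ σ gₙ`. -/
lemma abs_integral_mul_le_of_tendsto {σ : ℝ → ℝ} (hσ : Integrable σ) {M B : ℝ}
    {G : ℕ → ℝ → ℝ} {g : ℝ → ℝ} (hG : ∀ n, AEStronglyMeasurable (G n))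
    (hM : ∀ n t, |G n t| ≤ M)
    (hlim : ∀ᵐ t, Tendsto (fun n => G n t) atTop (𝓝 (g t)))
    (hB : ∀ n, |∫ t, σ t * G n t| ≤ B) : |∫ t, σ t * g t| ≤ B := by
  refine le_of_tendsto (Tendsto.abs (tendsto_integral_of_dominated_convergence
    (fun t => |σ t| * M) (fun n => hσ.1.mul (hG n)) (hσ.abs.mul_const M)
    (fun n => Eventually.of_forall fun t => ?_) ?_)) (Eventually.of_forall hB)
  · rw [Pi.mul_apply, Real.norm_eq_abs, abs_mul]
    exact mul_le_mul_of_nonneg_left (hM n t) (abs_nonneg _)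
  · filter_upwards [hlim] with t ht
    exact ht.const_mul _

/-- With the translation moved onto `ρ`, limits in `g` need only bounded convergence almost
everywhere. -/
lemma integral_mul_sub_eq {ρ g : ℝ → ℝ} (hρ : Integrable ρ) {M : ℝ}
    (hg : AEStronglyMeasurable g) (hM : ∀ t, |g t| ≤ M) (h : ℝ) :
    ∫ t, (ρ (t - h) - ρ t) * g t = ∫ t, ρ t * (g (t + h) - g t) := by
  have hi : Integrable fun t => ρ t * g t := hρ.mul_bdd hg (Eventually.of_forall hM)
  have hi1 : Integrable fun t => ρ t * g (t + h) :=
    hρ.mul_bdd (hg.comp_quasiMeasurePreserving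
      (measurePreserving_add_right volume h).quasiMeasurePreserving)
      (Eventually.of_forall fun t => hM (t + h))
  have hi2 : Integrable fun t => ρ (t - h) * g t := by
    simpa using hi1.comp_sub_right h
  simp only [sub_mul, mul_sub]
  rw [integral_sub hi2 hi, integral_sub hi1 hi]
  congr 1
  simpa using (integral_sub_right_eq_self (fun t => ρ t * g (t + h)) h)

/-- Cutting off and then mollifying both preserve the bound `M`, so the smooth case passes to the
limit twice. This generality is needed since the counting function is built from indicators. -/
lemma VariationBound.abs_integral_mul_sub_le {ρ : ℝ → ℝ} {V : ℝ} (hρi : Integrable ρ)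
    (hρ : VariationBound ρ V) {g : ℝ → ℝ} {M : ℝ} (hg : Measurable g)
    (hM : ∀ t, |g t| ≤ M) (h : ℝ) :
    |∫ t, ρ t * (g (t + h) - g t)| ≤ M * |h| * V := by
  have hM0 : 0 ≤ M := (abs_nonneg _).trans (hM 0)
  have hσ : Integrable fun t => ρ (t - h) - ρ t := (hρi.comp_sub_right h).sub hρi
  rw [← integral_mul_sub_eq hρi hg.aestronglyMeasurable hM]
  set I : ℕ → Set ℝ := fun n => Metric.closedBall 0 n with hI
  have hIM : ∀ n t, |(I n).indicator g t| ≤ M := fun n t => by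
    by_cases ht : t ∈ I n
    · simpa [ht] using hM t
    · simpa [ht] using hM0
  have hIm : ∀ n, Measurable ((I n).indicator g) := fun n => hg.indicator measurableSet_closedBall
  refine abs_integral_mul_le_of_tendsto hσ (G := fun n => (I n).indicator g)
    (fun n => (hIm n).aestronglyMeasurable) hIM
    (Eventually.of_forall fun t => ?_) fun n => ?_
  · refine tendsto_const_nhds.congr' ?_
    obtain ⟨N, hN⟩ := exists_nat_ge |t|
    filter_upwards [eventually_ge_atTop N] with n hn
    rw [Set.indicator_of_mem]
    rw [hI, mem_closedBall_zero_iff, Real.norm_eq_abs]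
    exact hN.trans (by exact_mod_cast hn)
  set g₀ := (I n).indicator g with hg₀
  have hloc : LocallyIntegrable g₀ := by
    refine Integrable.locallyIntegrable ?_
    rw [hg₀, integrable_indicator_iff measurableSet_closedBall]
    exact Measure.integrableOn_of_bounded measure_closedBall_lt_top.ne hg.aestronglyMeasurable
      (Eventually.of_forall hM)
  have hcs : HasCompactSupport g₀ :=
    HasCompactSupport.intro (isCompact_closedBall (0 : ℝ) n) fun t ht => by
      simp [hg₀, hI, Set.indicator_of_notMem ht]
  -- The ratio of the radii stays equal to `2`, as required for almost everywhere convergence of the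
  -- mollifications (`K := 2` below).
  let ψ : ℕ → ContDiffBump (0 : ℝ) := fun m =>
    ⟨1 / (m + 1) / 2, 1 / (m + 1), by positivity, half_lt_self (by positivity)⟩
  set G : ℕ → ℝ → ℝ := fun m =>
    MeasureTheory.convolution ((ψ m).normed volume) g₀ (ContinuousLinearMap.lsmul ℝ ℝ) volume
  have hGs : ∀ m, ContDiff ℝ (⊤ : ℕ∞) (G m) := fun m =>
    (ψ m).hasCompactSupport_normed.contDiff_convolution_left _ (ψ m).contDiff_normed hloc
  have hGc : ∀ m, HasCompactSupport (G m) := fun m =>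
    (ψ m).hasCompactSupport_normed.convolution _ hcs
  have hGM : ∀ m t, |G m t| ≤ M := fun m t => by
    have := dist_convolution_le (x₀ := t) (z₀ := (0 : ℝ)) (R := (ψ m).rOut) hM0
      ((ψ m).support_normed_eq (μ := volume)).subset (ψ m).nonneg_normed (ψ m).integral_normed
      (hIm n).aestronglyMeasurable (fun s _ => by simpa using hIM n s)
    rwa [Real.dist_eq, sub_zero] at this
  refine abs_integral_mul_le_of_tendsto hσ (G := G)
    (fun m => (hGs m).continuous.aestronglyMeasurable) hGM ?_ fun m => ?_
  · refine ContDiffBump.ae_convolution_tendsto_right_of_locallyIntegrable (K := 2) ?_ ?_ hloc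
    · exact tendsto_one_div_add_atTop_nhds_zero_nat
    · exact Eventually.of_forall fun m => by simp only [ψ]; linarith
  · rw [integral_mul_sub_eq hρi (hGs m).continuous.aestronglyMeasurable (hGM m)]
    exact hρ.abs_integral_mul_sub_le_of_contDiff (hGs m) (hGc m) (hGM m) h

/-- The law of a random variable with density of bounded variation changes little under
translations. -/
lemma lintegral_le_lintegral_add {μ : Measure ℝ} [IsProbabilityMeasure μ] {ρ : ℝ → ℝ} {V : ℝ}
    (hμ : IsDensity μ ρ) (hρi : Integrable ρ) (hρ : VariationBound ρ V) {g : ℝ → ℝ≥0∞} {M : ℝ}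
    (hM0 : 0 ≤ M) (hg : Measurable g) (hM : ∀ t, g t ≤ ENNReal.ofReal M) (h : ℝ) :
    ∫⁻ t, g t ∂μ ≤ ∫⁻ t, g (t + h) ∂μ + ENNReal.ofReal (M * V * |h|) := by
  set f : ℝ → ℝ := fun t => (g t).toReal with hf
  have hfg : ∀ t, g t = ENNReal.ofReal (f t) := fun t =>
    (ENNReal.ofReal_toReal (ne_top_of_le_ne_top ENNReal.ofReal_ne_top (hM t))).symm
  have hfm : Measurable f := hg.ennreal_toReal
  have hf0 : ∀ t, 0 ≤ f t := fun t => ENNReal.toReal_nonneg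
  have hfM : ∀ t, |f t| ≤ M := fun t => by
    rw [abs_of_nonneg (hf0 t)]
    exact ENNReal.toReal_le_of_le_ofReal hM0 (hM t)
  have hfi : ∀ s, Integrable (fun t => f (t + s)) μ := fun s =>
    Integrable.of_bound (hfm.comp (measurable_add_const s)).aestronglyMeasurable M
      (Eventually.of_forall fun t => hfM (t + s))
  have hintegral : ∀ s, ∫ t, f (t + s) ∂μ = ∫ t, ρ t * f (t + s) := fun s => by
    rw [hμ.2, integral_withDensity_eq_integral_toReal_smul₀ hρi.1.aemeasurable.ennreal_ofReal
      (Eventually.of_forall fun t => ENNReal.ofReal_lt_top)]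
    refine integral_congr_ae ?_
    filter_upwards [hμ.1] with t ht
    rw [ENNReal.toReal_ofReal ht, smul_eq_mul]
  have hρf : ∀ s, Integrable fun t => ρ t * f (t + s) := fun s =>
    hρi.mul_bdd (hfm.comp (measurable_add_const s)).aestronglyMeasurable
      (Eventually.of_forall fun t => hfM (t + s))
  have hl : ∀ s, ∫⁻ t, g (t + s) ∂μ = ENNReal.ofReal (∫ t, f (t + s) ∂μ) := fun s => by
    rw [ofReal_integral_eq_lintegral_ofReal (hfi s) (Eventually.of_forall fun t => hf0 _)]
    exact lintegral_congr fun t => hfg _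
  have key := hρ.abs_integral_mul_sub_le hρi hfm hfM h
  simp only [mul_sub] at key
  rw [integral_sub (hρf h) (by simpa using hρf 0), ← hintegral h] at key
  have h0 := hintegral 0
  have hl0 := hl 0
  simp only [add_zero] at h0 hl0
  rw [← h0] at key
  rw [hl0, hl h]
  refine (ENNReal.ofReal_le_ofReal ?_).trans ENNReal.ofReal_add_le
  have := (abs_le.1 key).1
  linarith

/-! ### Translates of product measures -/

/-- Resampling one coordinate does not change a product measure. -/
lemma infinitePi_map_update {ι : Type*} [DecidableEq ι] {X : ι → Type*}
    [∀ i, MeasurableSpace (X i)] (μ : ∀ i, Measure (X i)) [∀ i, IsProbabilityMeasure (μ i)]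
    (k : ι) :
    ((Measure.infinitePi μ).prod (μ k)).map (fun p => Function.update p.1 k p.2) =
      Measure.infinitePi μ := by
  have hm : Measurable fun p : (∀ i, X i) × X k => Function.update p.1 k p.2 :=
    measurable_update'
  refine Measure.eq_infinitePi μ fun s t ht => ?_
  rw [Measure.map_apply hm (MeasurableSet.pi s.countable_toSet fun i _ => ht i)]
  have hpre : (fun p : (∀ i, X i) × X k => Function.update p.1 k p.2) ⁻¹' Set.pi s t =
      Set.pi (s.erase k) t ×ˢ (if k ∈ s then t k else Set.univ) := by
    ext p
    simp only [Set.mem_preimage, Set.mem_pi, Finset.mem_coe, Set.mem_prod, Finset.mem_erase]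
    constructor
    · intro h
      refine ⟨fun i hi => by simpa [hi.1] using h i hi.2, ?_⟩
      split_ifs with hk
      · simpa using h k hk
      · trivial
    · rintro ⟨h1, h2⟩ i hi
      rcases eq_or_ne i k with rfl | hne
      · simpa [hi] using h2
      · simpa [hne] using h1 i ⟨hne, hi⟩
  rw [hpre, Measure.prod_prod, Measure.infinitePi_pi μ fun i _ => ht i]
  split_ifs with hk
  · rw [Finset.prod_erase_mul _ _ hk]
  · rw [measure_univ, mul_one, Finset.erase_eq_of_notMem hk]

section Shift

variable {d : ℕ} {μ : Measure ℝ} [IsProbabilityMeasure μ] {ρ : ℝ → ℝ} {V M : ℝ}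
  {G : (Site d → ℝ) → ℝ≥0∞}

/-- Resampling coordinate `k` turns the integral into an inner one over that coordinate with the
others frozen, where the one-dimensional estimate applies. -/
lemma lintegral_prodMeasure_le_single (hμ : IsDensity μ ρ) (hρi : Integrable ρ)
    (hρ : VariationBound ρ V) (hM0 : 0 ≤ M) (hG : Measurable G)
    (hM : ∀ ω, G ω ≤ ENNReal.ofReal M) (k : Site d) (h : ℝ) :
    ∫⁻ ω, G ω ∂prodMeasure d μ ≤
      ∫⁻ ω, G (ω + Pi.single k h) ∂prodMeasure d μ + ENNReal.ofReal (M * V * |h|) := by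
  have hm : Measurable fun p : (Site d → ℝ) × ℝ => Function.update p.1 k p.2 :=
    measurable_update'
  have hsplit : ∀ H : (Site d → ℝ) → ℝ≥0∞, Measurable H → ∫⁻ ω, H ω ∂prodMeasure d μ =
      ∫⁻ ω, ∫⁻ t, H (Function.update ω k t) ∂μ ∂prodMeasure d μ := fun H hH => by
    have := infinitePi_map_update (fun _ : Site d => μ) k
    rw [prodMeasure]
    conv_lhs => rw [← this]
    rw [lintegral_map hH hm]
    exact lintegral_prod _ (hH.comp hm).aemeasurable
  have hadd : Measurable fun ω : Site d → ℝ => ω + Pi.single k h := measurable_id.add_const _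
  have hG' := hsplit (fun ω => G (ω + Pi.single k h)) (hG.comp hadd)
  rw [hsplit G hG, hG']
  calc ∫⁻ ω, ∫⁻ t, G (Function.update ω k t) ∂μ ∂prodMeasure d μ
      ≤ ∫⁻ ω, (∫⁻ t, G (Function.update ω k (t + h)) ∂μ + ENNReal.ofReal (M * V * |h|))
          ∂prodMeasure d μ := by
        refine lintegral_mono fun ω => ?_
        exact lintegral_le_lintegral_add hμ hρi hρ hM0
          (hG.comp (hm.comp measurable_prodMk_left)) (fun t => hM _) h
    _ = _ := by
        rw [lintegral_add_right _ measurable_const, lintegral_const]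
        have : IsProbabilityMeasure (prodMeasure d μ) := by rw [prodMeasure]; infer_instance
        rw [measure_univ, mul_one]
        congr! 7 with ω t
        ext i
        rcases eq_or_ne i k with rfl | h
        · simp
        · simp [h]

/-- The coordinates are shifted one at a time; translates of `G` obey the same bound `M`, so the
costs add. -/
lemma lintegral_prodMeasure_le_sum (hμ : IsDensity μ ρ) (hρi : Integrable ρ)
    (hρ : VariationBound ρ V) (hM0 : 0 ≤ M) (hV : 0 ≤ V) (hG : Measurable G)
    (hM : ∀ ω, G ω ≤ ENNReal.ofReal M) (s : Finset (Site d)) (a : Site d → ℝ) :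
    ∫⁻ ω, G ω ∂prodMeasure d μ ≤
      ∫⁻ ω, G (ω + ∑ k ∈ s, Pi.single k (a k)) ∂prodMeasure d μ +
        ENNReal.ofReal (M * V * ∑ k ∈ s, |a k|) := by
  classical
  induction s using Finset.induction_on with
  | empty => simp
  | insert k s hk ih =>
    refine ih.trans ?_
    have hadd : Measurable fun ω : Site d → ℝ => ω + ∑ k ∈ s, Pi.single k (a k) :=
      measurable_id.add_const _
    have := lintegral_prodMeasure_le_single hμ hρi hρ hM0 (hG.comp hadd) (fun ω => hM _) k (a k)
    simp only [Function.comp_apply] at this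
    refine (add_le_add_left this _).trans ?_
    rw [Finset.sum_insert hk, Finset.sum_insert hk, add_assoc, mul_add,
      ENNReal.ofReal_add (by positivity) (by positivity)]
    simp only [add_assoc]
    rfl

end Shift

end AlloyType

namespace AlloyType

/-! ### Cubes and exponentially weighted sums -/

lemma norm1_cast {d : ℕ} (k : Site d) : (norm1 k : ℝ) = ∑ r, |(k r : ℝ)| := by
  simp [norm1]

lemma abs_apply_le_norm1 {d : ℕ} (k : Site d) (r : Fin d) : |(k r : ℝ)| ≤ norm1 k := by
  rw [norm1_cast]
  exact Finset.single_le_sum (f := fun r => |(k r : ℝ)|) (fun _ _ => abs_nonneg _)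
    (Finset.mem_univ r)

lemma norm1_nonneg {d : ℕ} (k : Site d) : (0 : ℝ) ≤ norm1 k := by
  rw [norm1_cast]; positivity

/-- The cube `cube l j` as a finite set. -/
noncomputable def cubeFinset {d : ℕ} (l : ℝ) (j : Site d) : Finset (Site d) :=
  Fintype.piFinset fun r => Finset.Icc ⌈(j r : ℝ) - l⌉ ⌊(j r : ℝ) + l⌋

lemma mem_cubeFinset {d : ℕ} {l : ℝ} {j k : Site d} : k ∈ cubeFinset l j ↔ k ∈ cube l j := by
  simp only [cubeFinset, Fintype.mem_piFinset, Finset.mem_Icc, Int.ceil_le, Int.le_floor, cube,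
    Set.mem_ofPred_eq]
  refine forall_congr' fun r => ?_
  rw [abs_le]
  constructor <;> rintro ⟨h1, h2⟩ <;> constructor <;> linarith

lemma card_cubeFinset_le {d : ℕ} {l : ℝ} (hl : 0 ≤ l) (j : Site d) :
    ((cubeFinset l j).card : ℝ) ≤ (2 * l + 1) ^ d := by
  rw [cubeFinset, Fintype.card_piFinset, Nat.cast_prod]
  refine (Finset.prod_le_prod (fun _ _ => by positivity) (g := fun _ => 2 * l + 1)
    fun r _ => ?_).trans_eq (by simp)
  rw [Int.card_Icc]
  have h1 := Int.floor_le ((j r : ℝ) + l)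
  have h2 := Int.le_ceil ((j r : ℝ) - l)
  have h3 : ((⌊(j r : ℝ) + l⌋ + 1 - ⌈(j r : ℝ) - l⌉ : ℤ) : ℝ) ≤ 2 * l + 1 := by
    push_cast; linarith
  rw [← Int.cast_natCast, Int.toNat_eq_max]
  push_cast at h3 ⊢
  exact max_le h3 (by linarith)

lemma lt_norm1_sub {d : ℕ} {l : ℝ} {x y k : Site d} (hx : x ∈ cube l y)
    (hk : k ∉ cube (4 * l) y) : 3 * l < norm1 (x - k) := by
  simp only [cube, Set.mem_ofPred_eq, not_forall, not_le] at hx hk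
  obtain ⟨r, hr⟩ := hk
  refine lt_of_lt_of_le ?_ (abs_apply_le_norm1 (x - k) r)
  have h1 := abs_sub_le (k r : ℝ) (x r) (y r)
  rw [abs_sub_comm (k r : ℝ) (x r)] at h1
  have := hx r
  push_cast [Pi.sub_apply]
  linarith

lemma summable_exp_norm1 {d : ℕ} {β : ℝ} (hβ : 0 < β) :
    Summable fun k : Site d => Real.exp (-β * norm1 k) := by
  have h1 : Summable fun n : ℤ => Real.exp (-β * |(n : ℝ)|) := by
    have hN : Summable fun n : ℕ => Real.exp (-β * (n : ℝ)) := by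
      simpa [mul_comm] using Real.summable_exp_nat_mul_iff.2 (neg_lt_zero.2 hβ)
    exact Summable.of_nat_of_neg (by simpa using hN) (by simpa using hN)
  refine summable_of_sum_le (c := ∏ _r : Fin d, ∑' n : ℤ, Real.exp (-β * |(n : ℝ)|))
    (fun k => (Real.exp_pos _).le) fun s => ?_
  have hs : s ⊆ Fintype.piFinset fun r => s.image fun k => k r := fun k hk => by
    rw [Fintype.mem_piFinset]
    exact fun r => Finset.mem_image_of_mem _ hk
  refine (Finset.sum_le_sum_of_subset_of_nonneg hs fun _ _ _ => (Real.exp_pos _).le).trans ?_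
  have : ∀ k : Site d, Real.exp (-β * norm1 k) = ∏ r, Real.exp (-β * |(k r : ℝ)|) := fun k => by
    rw [norm1_cast, Finset.mul_sum, Real.exp_sum]
  simp only [this]
  rw [← Finset.prod_univ_sum (t := fun r => s.image fun k => k r)
    (f := fun _ (n : ℤ) => Real.exp (-β * |(n : ℝ)|))]
  exact Finset.prod_le_prod (fun _ _ => Finset.sum_nonneg fun _ _ => (Real.exp_pos _).le)
    fun r _ => h1.sum_le_tsum _ fun _ _ => (Real.exp_pos _).le

/-- The sum `∑ₖ exp (-β ‖k‖₁)`. -/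
noncomputable def expSum (d : ℕ) (β : ℝ) : ℝ := ∑' k : Site d, Real.exp (-β * norm1 k)

lemma expSum_nonneg (d : ℕ) (β : ℝ) : 0 ≤ expSum d β := tsum_nonneg fun _ => (Real.exp_pos _).le

lemma hasSum_exp_norm1_sub {d : ℕ} {β : ℝ} (hβ : 0 < β) (x : Site d) :
    HasSum (fun k : Site d => Real.exp (-β * norm1 (x - k))) (expSum d β) :=
  (Equiv.subLeft x).hasSum_iff.2 (summable_exp_norm1 hβ).hasSum

/-- A sum with exponentially small terms outside the finite set `Γ` is approximated by the
partial sum over `Γ`. -/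
lemma abs_sub_sum_le_of_exp_bound {d : ℕ} {β : ℝ} (hβ : 0 < β) {f : Site d → ℝ} {c K : ℝ}
    (hf : HasSum f c) {Γ : Finset (Site d)} (hK : 0 ≤ K) (x : Site d)
    (hΓ : ∀ k ∉ Γ, |f k| ≤ K * Real.exp (-β * norm1 (x - k))) :
    |c - ∑ k ∈ Γ, f k| ≤ K * expSum d β := by
  classical
  have h1 : HasSum (fun k => if k ∈ Γ then f k else 0) (∑ k ∈ Γ, f k) := by
    have := hasSum_sum_of_ne_finset_zero (L := .unconditional _)
      (f := fun k => if k ∈ Γ then f k else 0) (s := Γ)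
      (fun k hk => if_neg hk)
    rwa [Finset.sum_congr rfl fun k hk => if_pos hk] at this
  rw [← (hf.sub h1).tsum_eq, ← Real.norm_eq_abs]
  refine tsum_of_norm_bounded ((hasSum_exp_norm1_sub hβ x).mul_left K) fun k => ?_
  by_cases hk : k ∈ Γ
  · simp only [hk, if_true, sub_self, norm_zero]
    positivity
  · simpa [hk] using hΓ k hk

/-! ### Falling factorials -/

/-- The falling factorial `n (n - 1) ⋯ (n - j + 1)`. -/
noncomputable def fallFact (n : ℤ) (j : ℕ) : ℤ := (descPochhammer ℤ j).eval n

lemma fallFact_zero (n : ℤ) : fallFact n 0 = 1 := by simp [fallFact]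

lemma fallFact_succ (n : ℤ) (j : ℕ) : fallFact n (j + 1) = fallFact n j * (n - j) := by
  simp [fallFact, descPochhammer_succ_eval]

lemma fallFact_eq (n : ℤ) (j : ℕ) : fallFact n j = j.factorial * Ring.choose n j := by
  have := Ring.descPochhammer_eq_factorial_smul_choose n j
  rw [← Polynomial.eval_eq_smeval, nsmul_eq_mul] at this
  exact this

lemma abs_fallFact_le (n : ℤ) (j : ℕ) : |(fallFact n j : ℝ)| ≤ (|(n : ℝ)| + j) ^ j := by
  induction j with
  | zero => simp [fallFact_zero]
  | succ j ih =>
    rw [fallFact_succ, pow_succ]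
    push_cast
    rw [abs_mul]
    have h : |(n : ℝ) - j| ≤ |(n : ℝ)| + (j + 1) := by
      refine (abs_sub _ _).trans ?_
      rw [Nat.abs_cast]; linarith
    refine mul_le_mul (ih.trans ?_) h (abs_nonneg _) (by positivity)
    gcongr
    linarith

lemma abs_choose_le (n : ℤ) (j : ℕ) : |((Ring.choose n j : ℤ) : ℝ)| ≤ (|(n : ℝ)| + j) ^ j := by
  refine le_trans ?_ (abs_fallFact_le n j)
  rw [fallFact_eq]
  push_cast
  rw [abs_mul, Nat.abs_cast]
  refine le_mul_of_one_le_left (abs_nonneg _) ?_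
  exact_mod_cast Nat.one_le_iff_ne_zero.2 j.factorial_ne_zero

/-- Powers are dominated by exponentials. -/
lemma exists_pow_le_exp {c : ℝ} (hc : 0 < c) (b : ℝ) (hb : 0 ≤ b) (j : ℕ) :
    ∃ K, 0 < K ∧ ∀ t, 0 ≤ t → (t + b) ^ j ≤ K * Real.exp (c * t) := by
  refine ⟨j.factorial / c ^ j * Real.exp (c * b), by positivity, fun t ht => ?_⟩
  have h := Real.pow_div_factorial_le_exp (c * (t + b)) (by positivity) j
  rw [div_le_iff₀ (by positivity), mul_pow] at h
  rw [div_mul_eq_mul_div, div_mul_eq_mul_div, le_div_iff₀ (by positivity), mul_assoc,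
    ← Real.exp_add, ← mul_add, add_comm b t]
  linarith

/-! ### Derivatives of the generating function -/

/-- The annulus `exp (-β) < |t| < exp β`. -/
def annulus (β : ℝ) : Set ℂ := {t | Real.exp (-β) < ‖t‖ ∧ ‖t‖ < Real.exp β}

lemma isOpen_annulus (β : ℝ) : IsOpen (annulus β) :=
  (isOpen_lt continuous_const continuous_norm).inter (isOpen_lt continuous_norm continuous_const)

lemma one_mem_annulus {β : ℝ} (hβ : 0 < β) : (1 : ℂ) ∈ annulus β := by
  simp [annulus, hβ]

lemma ne_zero_of_mem_annulus {β : ℝ} {t : ℂ} (ht : t ∈ annulus β) : t ≠ 0 :=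
  norm_pos_iff.1 ((Real.exp_pos _).trans ht.1)

lemma norm_zpow_le_of_mem_annulus {β : ℝ} {t : ℂ} (ht : t ∈ annulus β) (n : ℤ) :
    ‖t ^ n‖ ≤ Real.exp (β * |(n : ℝ)|) := by
  obtain ⟨m, rfl | rfl⟩ := n.eq_nat_or_neg
  · rw [zpow_natCast, norm_pow]
    refine (pow_le_pow_left₀ (norm_nonneg _) ht.2.le m).trans_eq ?_
    rw [← Real.exp_nat_mul]
    simp [mul_comm]
  · rw [zpow_neg, zpow_natCast, ← inv_pow, norm_pow, norm_inv]
    have h : ‖t‖⁻¹ ≤ Real.exp β := by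
      rw [inv_le_comm₀ ((Real.exp_pos _).trans ht.1) (Real.exp_pos _), ← Real.exp_neg]
      exact ht.1.le
    refine (pow_le_pow_left₀ (by positivity) h m).trans_eq ?_
    rw [← Real.exp_nat_mul]
    simp [mul_comm]

/-- The terms of the series `D^J F`. -/
noncomputable def derivTerm {d : ℕ} (u : Site d → ℝ) (J : Fin d → ℕ) (k : Site d)
    (z : Fin d → ℂ) : ℂ :=
  (u (-k) : ℂ) * ∏ r, ((fallFact (k r) (J r) : ℂ) * z r ^ (k r - J r))

section Deriv

variable {d : ℕ} {u : Site d → ℝ} {C α : ℝ}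

/-- Of the decay rate `α`, the powers of `z` consume `α / 2` and the falling factorials `α / 4`,
which leaves `α / 4` for summability. -/
lemma ExpDecay.exists_norm_derivTerm_le (hu : ExpDecay u C α) (J : Fin d → ℕ) :
    ∃ K, ∀ k z, (∀ r, z r ∈ annulus (α / 2)) →
      ‖derivTerm u J k z‖ ≤ K * Real.exp (-(α / 4) * norm1 k) := by
  obtain ⟨hC, hα, hu⟩ := hu
  have h1 : ∀ j : ℕ, ∃ K, 0 < K ∧ ∀ (n : ℤ) (t : ℂ), t ∈ annulus (α / 2) →
      ‖(fallFact n j : ℂ) * t ^ (n - j)‖ ≤ K * Real.exp (3 * α / 4 * |(n : ℝ)|) := fun j => by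
    obtain ⟨K, hK, h⟩ := exists_pow_le_exp (c := α / 4) (by positivity) j (by positivity) j
    refine ⟨K * Real.exp (α / 2 * j), by positivity, fun n t ht => ?_⟩
    rw [norm_mul, Complex.norm_intCast]
    have h2 := (abs_fallFact_le n j).trans (h _ (abs_nonneg _))
    have h3 : ‖t ^ (n - j)‖ ≤ Real.exp (α / 2 * (|(n : ℝ)| + j)) := by
      refine (norm_zpow_le_of_mem_annulus ht _).trans (Real.exp_le_exp.2 ?_)
      gcongr
      push_cast
      exact (abs_sub _ _).trans_eq (by rw [Nat.abs_cast])
    refine (mul_le_mul h2 h3 (norm_nonneg _) (by positivity)).trans_eq ?_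
    rw [mul_assoc, mul_assoc, ← Real.exp_add, ← Real.exp_add]
    ring_nf
  choose K hK h using h1
  refine ⟨C * ∏ r, K (J r), fun k z hz => ?_⟩
  rw [derivTerm, norm_mul, Complex.norm_real, norm_prod, Real.norm_eq_abs]
  have h2 : ∏ r, ‖(fallFact (k r) (J r) : ℂ) * z r ^ (k r - J r)‖ ≤
      (∏ r, K (J r)) * Real.exp (3 * α / 4 * norm1 k) := by
    rw [norm1_cast, Finset.mul_sum, Real.exp_sum, ← Finset.prod_mul_distrib]
    exact Finset.prod_le_prod (fun _ _ => norm_nonneg _) fun r _ => h _ _ _ (hz r)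
  have h3 := hu (-k)
  rw [norm1_neg] at h3
  refine (mul_le_mul h3 h2 (Finset.prod_nonneg fun _ _ => norm_nonneg _)
    (by positivity)).trans_eq ?_
  rw [mul_mul_mul_comm, ← Real.exp_add]
  ring_nf

/-- Termwise differentiation in one variable by locally uniform convergence of holomorphic
functions. The annulus is open and avoids zero, as the negative exponents demand. -/
lemma ExpDecay.partialDeriv_eq (hu : ExpDecay u C α) {H : (Fin d → ℂ) → ℂ} {J : Fin d → ℕ}
    (hH : ∀ z, (∀ r, z r ∈ annulus (α / 2)) → H z = ∑' k, derivTerm u J k z) (r : Fin d)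
    (z : Fin d → ℂ) (hz : ∀ r, z r ∈ annulus (α / 2)) :
    partialDeriv r H z = ∑' k, derivTerm u (J + Pi.single r 1) k z := by
  obtain ⟨K, hK⟩ := hu.exists_norm_derivTerm_le J
  have hα : 0 < α / 4 := by have := hu.2.1; positivity
  have hup : ∀ t ∈ annulus (α / 2), ∀ s, Function.update z r t s ∈ annulus (α / 2) :=
    fun t ht s => by
      rcases eq_or_ne s r with rfl | hs
      · simpa using ht
      · simpa [hs] using hz s
  have hterm : ∀ k, (fun t => derivTerm u J k (Function.update z r t)) = fun t =>
      ((u (-k) : ℂ) * fallFact (k r) (J r) *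
        ∏ s ∈ Finset.univ.erase r, ((fallFact (k s) (J s) : ℂ) * z s ^ (k s - J s))) *
        t ^ (k r - J r) := fun k => by
    funext t
    rw [derivTerm, ← Finset.mul_prod_erase _ _ (Finset.mem_univ r), Function.update_self,
      Finset.prod_congr rfl (g := fun s => (fallFact (k s) (J s) : ℂ) * z s ^ (k s - J s))
        fun s hs => by rw [Function.update_of_ne (Finset.ne_of_mem_erase hs)]]
    ring
  have hsum := Complex.hasSum_deriv_of_summable_norm (U := annulus (α / 2)) (z := z r)
    (F := fun k t => derivTerm u J k (Function.update z r t))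
    ((summable_exp_norm1 (d := d) hα).mul_left K) (fun k => by
      rw [hterm]
      intro t ht
      exact ((differentiableAt_zpow.2 (Or.inl (ne_zero_of_mem_annulus ht))).const_mul
        _).differentiableWithinAt)
    (isOpen_annulus _) (fun k t ht => hK k _ (hup t ht)) (hz r)
  have hev : (fun t => H (Function.update z r t)) =ᶠ[nhds (z r)]
      fun t => ∑' k, derivTerm u J k (Function.update z r t) := by
    filter_upwards [(isOpen_annulus _).mem_nhds (hz r)] with t ht
    exact hH _ (hup t ht)
  rw [partialDeriv, hev.deriv_eq, ← hsum.tsum_eq]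
  refine tsum_congr fun k => ?_
  rw [hterm, deriv_const_mul _ (differentiableAt_zpow.2 (Or.inl (ne_zero_of_mem_annulus (hz r)))),
    deriv_zpow, derivTerm, ← Finset.mul_prod_erase _ _ (Finset.mem_univ r)]
  have hrest : ∏ s ∈ Finset.univ.erase r,
      ((fallFact (k s) ((J + Pi.single r 1 : Fin d → ℕ) s) : ℂ) *
      z s ^ (k s - ((J + Pi.single r 1 : Fin d → ℕ) s : ℕ))) =
      ∏ s ∈ Finset.univ.erase r, ((fallFact (k s) (J s) : ℂ) * z s ^ (k s - J s)) :=
    Finset.prod_congr rfl fun s hs => by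
      rw [Pi.add_apply, Pi.single_eq_of_ne (Finset.ne_of_mem_erase hs), add_zero]
  rw [hrest]
  simp only [Pi.add_apply, Pi.single_eq_same, fallFact_succ]
  push_cast
  rw [sub_sub]
  ring

lemma ExpDecay.iterate_partialDeriv_eq (hu : ExpDecay u C α) {H : (Fin d → ℂ) → ℂ}
    {J : Fin d → ℕ}
    (hH : ∀ z, (∀ r, z r ∈ annulus (α / 2)) → H z = ∑' k, derivTerm u J k z) (r : Fin d) (n : ℕ)
    (z : Fin d → ℂ) (hz : ∀ r, z r ∈ annulus (α / 2)) :
    (partialDeriv r)^[n] H z = ∑' k, derivTerm u (J + Pi.single r n) k z := by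
  induction n generalizing z with
  | zero => simpa using hH z hz
  | succ n ih =>
    rw [Function.iterate_succ_apply', hu.partialDeriv_eq ih r z hz, add_assoc, ← Pi.single_add]

lemma ExpDecay.multiDeriv_genFun_eq (hu : ExpDecay u C α) (I : Fin d → ℕ)
    (z : Fin d → ℂ) (hz : ∀ r, z r ∈ annulus (α / 2)) :
    multiDeriv I (genFun u) z = ∑' k, derivTerm u I k z := by
  have key : ∀ (L : List (Fin d)) (z : Fin d → ℂ), (∀ r, z r ∈ annulus (α / 2)) →
      L.foldr (fun r H => (partialDeriv r)^[I r] H) (genFun u) z =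
        ∑' k, derivTerm u (L.map fun r => (Pi.single r (I r) : Fin d → ℕ)).sum k z := by
    intro L
    induction L with
    | nil =>
      intro z hz
      simp [genFun, derivTerm, fallFact_zero]
    | cons r L ih =>
      intro z hz
      rw [List.foldr_cons, hu.iterate_partialDeriv_eq ih r (I r) z hz, List.map_cons,
        List.sum_cons, add_comm]
  rw [multiDeriv, key _ z hz, ← List.ofFn_eq_map, List.sum_ofFn, Finset.univ_sum_single]

/-! ### Moments of the single-site potential -/

lemma ExpDecay.summable_mul_prod_choose (hu : ExpDecay u C α) (I : Fin d → ℕ) :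
    Summable fun k : Site d => u (-k) * ∏ r, ((Ring.choose (k r) (I r) : ℤ) : ℝ) := by
  obtain ⟨K, hK⟩ := hu.exists_norm_derivTerm_le I
  have hα := hu.2.1
  refine Summable.of_norm_bounded
    ((summable_exp_norm1 (d := d) (β := α / 4) (by positivity)).mul_left K) fun k => ?_
  refine le_trans ?_ (hK k 1 fun r => one_mem_annulus (by positivity))
  simp only [derivTerm, Pi.one_apply, one_zpow, mul_one, norm_mul, norm_prod, Complex.norm_real,
    Complex.norm_intCast, Real.norm_eq_abs]
  refine mul_le_mul_of_nonneg_left ?_ (abs_nonneg _)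
  refine Finset.prod_le_prod (fun _ _ => abs_nonneg _) fun r _ => ?_
  rw [fallFact_eq]
  push_cast
  rw [abs_mul, Nat.abs_cast]
  refine le_mul_of_one_le_left (abs_nonneg _) ?_
  exact_mod_cast Nat.one_le_iff_ne_zero.2 (Nat.factorial_ne_zero _)

/-- The binomial moment `∑ₖ u (-k) ∏ᵣ (kᵣ choose Iᵣ)`. -/
noncomputable def moment (u : Site d → ℝ) (I : Fin d → ℕ) : ℝ :=
  ∑' k : Site d, u (-k) * ∏ r, ((Ring.choose (k r) (I r) : ℤ) : ℝ)

lemma ExpDecay.multiDeriv_genFun_one (hu : ExpDecay u C α) (I : Fin d → ℕ) :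
    multiDeriv I (genFun u) 1 = ((∏ r, ((I r).factorial : ℝ)) * moment u I : ℝ) := by
  have hα := hu.2.1
  rw [hu.multiDeriv_genFun_eq I 1 fun r => one_mem_annulus (by positivity), moment, ← tsum_mul_left,
    Complex.ofReal_tsum]
  refine tsum_congr fun k => ?_
  simp only [derivTerm, fallFact_eq, Pi.one_apply, one_zpow, mul_one]
  push_cast
  rw [Finset.prod_mul_distrib]
  ring

lemma IsLeadingIndex.moment_ne_zero (hu : ExpDecay u C α) {I₀ : Fin d → ℕ}
    (hI₀ : IsLeadingIndex u I₀) : moment u I₀ ≠ 0 := fun h =>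
  hI₀.1 (by rw [hu.multiDeriv_genFun_one, h]; simp)

lemma IsLeadingIndex.moment_eq_zero (hu : ExpDecay u C α) {I₀ : Fin d → ℕ}
    (hI₀ : IsLeadingIndex u I₀) {I : Fin d → ℕ} (hI : I < I₀) : moment u I = 0 := by
  have := hI₀.2 I hI
  rw [hu.multiDeriv_genFun_one, Complex.ofReal_eq_zero, mul_eq_zero] at this
  refine this.resolve_left ?_
  exact Finset.prod_ne_zero_iff.2 fun r _ => by exact_mod_cast Nat.factorial_ne_zero _

/-- The coefficients of the linear combination of translates of `u` that is constant. -/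
noncomputable def weight (I : Fin d → ℕ) (k : Site d) : ℝ :=
  ∏ r, ((Ring.choose (k r) (I r) : ℤ) : ℝ)

/-- Vandermonde in each coordinate expands the shifted weight into moments of orders `I ≤ I₀`. Those
with `I < I₀` vanish, and the remaining one has coefficient `1`, so the sum does not depend on `s`.
-/
lemma IsLeadingIndex.hasSum_weight_add (hu : ExpDecay u C α) {I₀ : Fin d → ℕ}
    (hI₀ : IsLeadingIndex u I₀) (s : Site d) :
    HasSum (fun k => u (-k) * weight I₀ (k + s)) (moment u I₀) := by
  classical
  let P := Fintype.piFinset fun r => Finset.HasAntidiagonal.antidiagonal (I₀ r)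
  have h1 : ∀ k, u (-k) * weight I₀ (k + s) = ∑ p ∈ P,
      (∏ r, ((Ring.choose (s r) (p r).2 : ℤ) : ℝ)) *
        (u (-k) * ∏ r, ((Ring.choose (k r) (p r).1 : ℤ) : ℝ)) := fun k => by
    simp only [weight, Pi.add_apply, fun r =>
      Ring.add_choose_eq (I₀ r) (Commute.all (k r) (s r))]
    push_cast
    rw [Finset.prod_univ_sum, Finset.mul_sum]
    refine Finset.sum_congr rfl fun p _ => ?_
    rw [Finset.prod_mul_distrib]
    ring
  have h2 : HasSum (fun k => u (-k) * weight I₀ (k + s)) (∑ p ∈ P,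
      (∏ r, ((Ring.choose (s r) (p r).2 : ℤ) : ℝ)) * moment u fun r => (p r).1) := by
    simp only [h1]
    exact hasSum_sum fun p _ =>
      (hu.summable_mul_prod_choose fun r => (p r).1).hasSum.mul_left _
  convert h2
  rw [Finset.sum_eq_single fun r => (I₀ r, 0)]
  · simp
  · intro p hp hne
    have hp' : ∀ r, (p r).1 + (p r).2 = I₀ r := fun r => by
      simpa using Fintype.mem_piFinset.1 hp r
    rw [hI₀.moment_eq_zero hu, mul_zero]
    refine lt_of_le_of_ne (fun r => by rw [← hp' r]; exact Nat.le_add_right _ _) fun heq => hne ?_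
    funext r
    have := congrFun heq r
    have := hp' r
    ext <;> simp <;> lia
  · intro h
    exact absurd (Fintype.mem_piFinset.2 fun r => by simp) h

lemma IsLeadingIndex.hasSum_weight_sub (hu : ExpDecay u C α) {I₀ : Fin d → ℕ}
    (hI₀ : IsLeadingIndex u I₀) (x y : Site d) :
    HasSum (fun k => weight I₀ (k - y) * u (x - k)) (moment u I₀) := by
  convert (Equiv.subRight x).hasSum_iff.2 (hI₀.hasSum_weight_add hu (x - y)) using 1
  funext k
  simp [mul_comm]

lemma abs_weight_le (I : Fin d → ℕ) {k : Site d} {t : ℝ} (ht : ∀ r, |(k r : ℝ)| ≤ t) :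
    |weight I k| ≤ (t + ∑ r, I r) ^ ∑ r, I r := by
  rw [weight, Finset.abs_prod, ← Finset.prod_pow_eq_pow_sum]
  refine Finset.prod_le_prod (fun _ _ => abs_nonneg _) fun r _ => (abs_choose_le _ _).trans ?_
  gcongr
  · exact ht r
  · exact_mod_cast Finset.single_le_sum (f := I) (fun _ _ => Nat.zero_le _) (Finset.mem_univ r)

/-- On large cubes the truncated linear combination of translates of `u` is bounded away from
zero. -/
lemma IsLeadingIndex.exists_half_le (hu : ExpDecay u C α) {I₀ : Fin d → ℕ}
    (hI₀ : IsLeadingIndex u I₀) : ∃ l₀ : ℝ, ∀ (l : ℝ) (x y : Site d), 0 < l → l₀ ≤ l →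
      x ∈ cube l y → |moment u I₀| / 2 ≤ SignType.sign (moment u I₀) *
        ∑ k ∈ cubeFinset (4 * l) y, weight I₀ (k - y) * u (x - k) := by
  set c := moment u I₀ with hc
  have hc0 : 0 < |c| := abs_pos.2 (hI₀.moment_ne_zero hu)
  obtain ⟨hC, hα, hdec⟩ := id hu
  set N := ∑ r, I₀ r with hN
  -- The rate `α / 8` is applied at `2 * q`, so the weights grow at rate `α / 4`. Of the remaining
  -- `3 * α / 4`, the part `α / 2` meets `q > 3 * l` and `α / 4` is kept for summation.
  obtain ⟨K, hK, hpow⟩ := exists_pow_le_exp (c := α / 8) (by positivity) N (by positivity) N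
  set B := C * K * expSum d (α / 4) with hB
  have hB0 : 0 ≤ B := mul_nonneg (by positivity) (expSum_nonneg _ _)
  have hlim : Filter.Tendsto (fun l : ℝ => B * Real.exp (-(3 * α / 2 * l))) Filter.atTop
      (nhds 0) := by
    have := (Real.tendsto_exp_neg_atTop_nhds_zero.comp
      (Filter.tendsto_id.const_mul_atTop (by positivity : 0 < 3 * α / 2))).const_mul B
    simpa using this
  obtain ⟨l₀, hl₀⟩ := Filter.eventually_atTop.1 (hlim.eventually_lt_const (half_pos hc0))
  refine ⟨l₀, fun l x y hl hl' hx => ?_⟩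
  have htail : |c - ∑ k ∈ cubeFinset (4 * l) y, weight I₀ (k - y) * u (x - k)| ≤
      C * K * Real.exp (-(3 * α / 2 * l)) * expSum d (α / 4) := by
    refine abs_sub_sum_le_of_exp_bound (by positivity) (hI₀.hasSum_weight_sub hu x y)
      (by positivity) x fun k hk => ?_
    have hq := lt_norm1_sub hx (mem_cubeFinset.not.1 hk)
    set q : ℝ := ((norm1 (x - k) : ℤ) : ℝ) with hqdef
    have hq0 : 0 ≤ q := norm1_nonneg _
    have hw : |weight I₀ (k - y)| ≤ K * Real.exp (α / 4 * q) := by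
      -- Each coordinate of `k - y` is at most `q + l`, and `l ≤ q` because `3 * l < q`.
      refine (abs_weight_le I₀ (t := 2 * q) (fun r => ?_)).trans
        ((hpow _ (by positivity)).trans_eq (by ring_nf))
      have h1 := abs_sub_le (k r : ℝ) (x r) (y r)
      have h2 := abs_apply_le_norm1 (x - k) r
      have h3 := hx r
      rw [abs_sub_comm (k r : ℝ) (x r)] at h1
      push_cast [Pi.sub_apply] at h2 ⊢
      linarith
    rw [abs_mul]
    refine (mul_le_mul hw (hdec (x - k)) (abs_nonneg _) (by positivity)).trans ?_
    calc K * Real.exp (α / 4 * q) * (C * Real.exp (-α * q))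
        = C * K * Real.exp (α / 4 * q + -α * q) := by rw [Real.exp_add]; ring
      _ ≤ C * K * Real.exp (-(3 * α / 2 * l) + -(α / 4) * q) := by
          have := mul_lt_mul_of_pos_left hq hα
          gcongr ?_ * Real.exp ?_
          linarith
      _ = _ := by rw [Real.exp_add]; ring
  have hlt : |c - ∑ k ∈ cubeFinset (4 * l) y, weight I₀ (k - y) * u (x - k)| ≤ |c| / 2 :=
    htail.trans ((le_of_eq (by rw [hB]; ring)).trans (hl₀ l hl').le)
  rcases lt_or_gt_of_ne (abs_pos.1 hc0) with h | h
  · rw [sign_neg h]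
    rw [abs_of_neg h] at hlt ⊢
    have := abs_le.1 hlt
    simp only [SignType.coe_neg_one]
    linarith
  · rw [sign_pos h]
    rw [abs_of_pos h] at hlt ⊢
    have := abs_le.1 hlt
    simp only [SignType.coe_one]
    linarith

end Deriv

end AlloyType

namespace AlloyType

/-! ### Truncation of the potential -/

/-- The part of the potential generated by the sites in `Γ`. -/
noncomputable def localPotential {d : ℕ} (u : Site d → ℝ) (Γ : Finset (Site d)) (ω : Site d → ℝ)
    (x : Site d) : ℝ := ∑ k ∈ Γ, ω k * u (x - k)

/-- Omitted sites have distance greater than `3 * l` from `x`. Half of the decay rate yields the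
exponential factor in `l`, the other half makes the tail summable. -/
lemma ExpDecay.abs_potential_sub_le {d : ℕ} {u : Site d → ℝ} {C α : ℝ} (hu : ExpDecay u C α)
    {ω : Site d → ℝ} {R : ℝ} (hR : ∀ k, |ω k| ≤ R) {l : ℝ} {x y : Site d} (hx : x ∈ cube l y) :
    |potential u ω x - localPotential u (cubeFinset (4 * l) y) ω x| ≤
      R * C * Real.exp (-(3 * l * α / 2)) * expSum d (α / 2) := by
  obtain ⟨hC, hα, hdec⟩ := hu
  have hR0 : 0 ≤ R := (abs_nonneg _).trans (hR 0)
  have hb : ∀ k, |ω k * u (x - k)| ≤ R * C * Real.exp (-α * norm1 (x - k)) := fun k => by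
    rw [abs_mul, mul_assoc]
    exact mul_le_mul (hR k) (hdec _) (abs_nonneg _) hR0
  have hs : Summable fun k => ω k * u (x - k) :=
    Summable.of_norm_bounded ((hasSum_exp_norm1_sub hα x).summable.mul_left (R * C)) hb
  refine abs_sub_sum_le_of_exp_bound (by positivity) hs.hasSum (by positivity) x fun k hk => ?_
  refine (hb k).trans ?_
  have hq := lt_norm1_sub hx (mem_cubeFinset.not.1 hk)
  rw [mul_assoc (R * C), ← Real.exp_add]
  have := mul_lt_mul_of_pos_left hq hα
  gcongr ?_ * Real.exp ?_
  linarith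

noncomputable instance {d : ℕ} (l : ℝ) (j : Site d) : Fintype (cube l j) :=
  Fintype.ofFinset (cubeFinset l j) fun _ => mem_cubeFinset

lemma card_cube_le {d : ℕ} {l : ℝ} (hl : 0 ≤ l) (j : Site d) :
    (Fintype.card (cube l j) : ℝ) ≤ (2 * l + 1) ^ d := by
  rw [Fintype.card_ofFinset]
  exact card_cubeFinset_le hl j

/-- The ordered eigenvalues of the operator on the cube with radius `l`, where only the couplings
in the cube with radius `4 * l` are taken into account. -/
noncomputable def cubeEig {d : ℕ} (u : Site d → ℝ) (l : ℝ) (y : Site d)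
    (i : Fin (Fintype.card (cube l y))) (ω : Site d → ℝ) : ℝ :=
  eig (cube l y) (fun x => localPotential u (cubeFinset (4 * l) y) ω x) i

lemma measurable_cubeEig {d : ℕ} (u : Site d → ℝ) (l : ℝ) (y : Site d)
    (i : Fin (Fintype.card (cube l y))) : Measurable (cubeEig u l y i) := by
  refine (continuous_eig (cube l y) i).measurable.comp (measurable_pi_iff.2 fun x => ?_)
  exact Finset.measurable_sum _ fun k _ => (measurable_pi_apply k).mul_const _

/-- Every point of the spectrum for some choice of the couplings far from the cube is close to a
truncated eigenvalue. -/
lemma ExpDecay.exists_cubeEig_near {d : ℕ} {u : Site d → ℝ} {C α : ℝ} (hu : ExpDecay u C α)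
    {μ : Measure ℝ} {R : ℝ} (hR : ∀ t ∈ μ.support, |t| ≤ R) {l : ℝ} {y : Site d}
    {ω : Site d → ℝ} (hω : ω ∈ conf d μ) {ω' : ((cube (4 * l) y)ᶜ : Set (Site d)) → ℝ}
    (hω' : ω' ∈ confOn μ (cube (4 * l) y)ᶜ) {a : ℂ}
    (ha : a ∈ spectrum ℂ (boxOp u (cube l y)
      (glue (cube (4 * l) y) ((cube (4 * l) y).domRestrict ω) ω'))) :
    ∃ i, ∃ t : ℝ, a = t ∧
      |t - cubeEig u l y i ω| ≤ R * C * Real.exp (-(3 * l * α / 2)) * expSum d (α / 2) := by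
  obtain ⟨i, rfl⟩ := spectrum_boxOp_subset _ _ _ ha
  refine ⟨i, _, rfl, abs_eig_sub_le _ (fun x => ?_) i⟩
  have hglue : ∀ k, |glue (cube (4 * l) y) ((cube (4 * l) y).domRestrict ω) ω' k| ≤ R := fun k => by
    rw [glue]
    split_ifs with hk
    · exact hR _ (hω k)
    · exact hR _ (hω' _)
  convert hu.abs_potential_sub_le hglue x.2 using 3
  refine Finset.sum_congr rfl fun k hk => ?_
  rw [glue, dif_pos (mem_cubeFinset.1 hk)]
  rfl

/-- A strict inequality for the infimum yields exterior configurations that realise it; the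
truncated eigenvalues do not depend on them. -/
lemma ExpDecay.exists_of_mem_resonanceEvent {d : ℕ} {u : Site d → ℝ} {C α : ℝ}
    (hu : ExpDecay u C α) {μ : Measure ℝ} {R : ℝ} (hR : ∀ t ∈ μ.support, |t| ≤ R)
    {x y : Site d} {l₁ l₂ ε : ℝ} {ω : Site d → ℝ}
    (hω : ω ∈ resonanceEvent u μ x y l₁ l₂ ε) :
    ∃ i j, |cubeEig u l₁ x i ω - cubeEig u l₂ y j ω| <
      ε + R * C * Real.exp (-(3 * l₁ * α / 2)) * expSum d (α / 2) +
        R * C * Real.exp (-(3 * l₂ * α / 2)) * expSum d (α / 2) := by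
  obtain ⟨hconf, hlt⟩ := hω
  simp only [unifDist, setDist, iInf_lt_iff] at hlt
  obtain ⟨ω₁, hω₁, ω₂, hω₂, a, ha, b, hb, hab⟩ := hlt
  obtain ⟨i, s, rfl, hs⟩ := hu.exists_cubeEig_near hR hconf hω₁ ha
  obtain ⟨j, t, rfl, ht⟩ := hu.exists_cubeEig_near hR hconf hω₂ hb
  refine ⟨i, j, ?_⟩
  rw [edist_lt_ofReal, dist_eq_norm, ← Complex.ofReal_sub, Complex.norm_real,
    Real.norm_eq_abs] at hab
  have h1 := abs_le.1 hs
  have h2 := abs_le.1 ht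
  have h3 := abs_lt.1 hab
  rw [abs_lt]
  constructor <;> linarith

/-! ### The resonance probability -/

/-- If the translation by `∑ a k` raises all `lam j` by at least `2 * ε` and leaves the `E i`
invariant, then some `lam j` is `ε`-close to some `E i` only with small probability. -/
lemma prodMeasure_close_le {d : ℕ} {μ : Measure ℝ} [IsProbabilityMeasure μ] {ρ : ℝ → ℝ} {V : ℝ}
    (hμ : IsDensity μ ρ) (hρi : Integrable ρ) (hρ : VariationBound ρ V) (hV : 0 ≤ V)
    {ι κ : Type*} [Fintype ι] [Fintype κ] {E : ι → (Site d → ℝ) → ℝ}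
    {lam : κ → (Site d → ℝ) → ℝ} (hE : ∀ i, Measurable (E i)) (hlam : ∀ j, Measurable (lam j))
    (s : Finset (Site d)) (a : Site d → ℝ) {ε : ℝ} (hε : 0 < ε)
    (hEa : ∀ i ω, E i (ω + ∑ k ∈ s, Pi.single k (a k)) = E i ω)
    (hla : ∀ j ω, lam j ω + 2 * ε ≤ lam j (ω + ∑ k ∈ s, Pi.single k (a k))) :
    prodMeasure d μ {ω | ∃ i j, |E i ω - lam j ω| < ε} ≤
      ENNReal.ofReal (Fintype.card ι * Fintype.card κ * V * ∑ k ∈ s, |a k|) := by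
  classical
  have : IsProbabilityMeasure (prodMeasure d μ) := by rw [prodMeasure]; infer_instance
  set b : Site d → ℝ := ∑ k ∈ s, Pi.single k (a k) with hb
  set S : ι × κ → Set (Site d → ℝ) := fun p => {ω | lam p.2 ω < E p.1 ω + ε} with hS
  have hSm : ∀ p, MeasurableSet (S p) := fun p =>
    measurableSet_lt (hlam p.2) ((hE p.1).add_const ε)
  set G : (Site d → ℝ) → ℝ≥0∞ := fun ω => ∑ p, (S p).indicator 1 ω with hG
  have hGm : Measurable G :=
    Finset.measurable_sum _ fun p _ => measurable_one.indicator (hSm p)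
  have hG1 : ∀ ω, G ω ≤ ENNReal.ofReal (Fintype.card ι * Fintype.card κ) := fun ω => by
    refine (Finset.sum_le_card_nsmul _ _ 1 fun p _ => Set.indicator_le_self' (by simp) ω).trans ?_
    rw [Finset.card_univ, Fintype.card_prod, nsmul_one, ← Nat.cast_mul, ENNReal.ofReal_natCast]
  set B : Set (Site d → ℝ) := {ω | ∃ i j, |E i ω - lam j ω| < ε} with hB
  have hBm : MeasurableSet B := by
    simp only [hB, Set.ofPred_exists]
    refine MeasurableSet.iUnion fun i => MeasurableSet.iUnion fun j => ?_
    exact measurableSet_lt ((hE i).sub (hlam j)).abs measurable_const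
  have hmono : ∀ p ω, ω + b ∈ S p → ω ∈ S p := fun p ω h => by
    have h1 := hla p.2 ω
    have h2 := hEa p.1 ω
    simp only [hS, Set.mem_ofPred_eq] at h ⊢
    linarith
  have hle : ∀ p ω, (S p).indicator (1 : (Site d → ℝ) → ℝ≥0∞) (ω + b) ≤ (S p).indicator 1 ω :=
    fun p ω => by
      by_cases h : ω + b ∈ S p
      · simp [h, hmono p ω h]
      · simp [h]
  -- On `B` a close pair is counted at `ω`, and since `lam j ω > E i ω - ε`, the rise by `2 * ε`
  -- takes it out of the count at `ω + b`.
  have hpt : ∀ ω, B.indicator 1 ω + G (ω + b) ≤ G ω := fun ω => by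
    by_cases hω : ω ∈ B
    · obtain ⟨i, j, hij⟩ := id hω
      have hij := abs_lt.1 hij
      have h1 : ω ∈ S (i, j) := by
        simp only [hS, Set.mem_ofPred_eq]
        linarith
      have h2 : ω + b ∉ S (i, j) := by
        have h3 := hla j ω
        have h4 := hEa i ω
        simp only [hS, Set.mem_ofPred_eq, not_lt]
        linarith
      have hone : (1 : ℝ≥0∞) = ∑ p : ι × κ, if p = (i, j) then 1 else 0 := by simp
      rw [Set.indicator_of_mem hω, Pi.one_apply, hone, hG, ← Finset.sum_add_distrib]
      refine Finset.sum_le_sum fun p _ => ?_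
      rcases eq_or_ne p (i, j) with rfl | hp
      · simp [h1, h2]
      · simpa [hp] using hle p ω
    · rw [Set.indicator_of_notMem hω, zero_add]
      exact Finset.sum_le_sum fun p _ => hle p ω
  have hintegral := lintegral_prodMeasure_le_sum hμ hρi hρ (by positivity) hV hGm hG1 s a
  rw [← hb] at hintegral
  have hadd : prodMeasure d μ B + ∫⁻ ω, G (ω + b) ∂prodMeasure d μ ≤
      ∫⁻ ω, G ω ∂prodMeasure d μ := by
    rw [← lintegral_indicator_one hBm, ← lintegral_add_left (measurable_one.indicator hBm)]
    exact lintegral_mono hpt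
  have hfin : ∫⁻ ω, G (ω + b) ∂prodMeasure d μ ≠ ⊤ := by
    refine ne_top_of_le_ne_top
      (ENNReal.ofReal_ne_top (r := Fintype.card ι * Fintype.card κ))
      ((lintegral_mono fun ω => hG1 (ω + b)).trans_eq ?_)
    rw [lintegral_const, measure_univ, mul_one]
  have := hadd.trans hintegral
  rw [add_comm] at this
  exact (ENNReal.add_le_add_iff_left hfin).1 this

lemma sum_single_apply {d : ℕ} (s : Finset (Site d)) (a : Site d → ℝ) (k : Site d) :
    (∑ k ∈ s, Pi.single k (a k) : Site d → ℝ) k = if k ∈ s then a k else 0 := by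
  rw [Finset.sum_apply, Finset.sum_pi_single]

/-- The exponent of the side length collects `2 * d` from the pairs of eigenvalues, `d` from the
number of shifted couplings and `∑ r, I r` from the size of the weights. -/
theorem prodMeasure_cubeEig_close_le {d : ℕ} {u : Site d → ℝ} {μ : Measure ℝ}
    [IsProbabilityMeasure μ] {ρ : ℝ → ℝ} {V : ℝ} (hμ : IsDensity μ ρ) (hρi : Integrable ρ)
    (hρ : VariationBound ρ V) (hV : 0 ≤ V) {x y : Site d} {l₁ l₂ : ℝ} (hl₁ : 0 < l₁)
    (hl₂ : 0 < l₂) (hdisj : Disjoint (cube (4 * l₁) x) (cube (4 * l₂) y))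
    (I : Fin d → ℕ) {c σ : ℝ} (hc : 0 < c) (hσ : |σ| ≤ 1)
    (hcov : ∀ z ∈ cube l₂ y,
      c / 2 ≤ σ * ∑ k ∈ cubeFinset (4 * l₂) y, weight I (k - y) * u (z - k))
    {ε : ℝ} (hε : 0 < ε) :
    (prodMeasure d μ).real {ω | ∃ i j, |cubeEig u l₁ x i ω - cubeEig u l₂ y j ω| < ε} ≤
      4 ^ d * (2 + ∑ r, I r : ℝ) ^ (∑ r, I r) * (4 / c) * V *
        (2 * max l₁ l₂ + 1) ^ (3 * d + ∑ r, I r) * ε := by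
  -- Chosen so that a combination of size at least `c / 2` raises the potential by at least `2 * ε`.
  set T := 4 * ε / c with hT
  set Γ := cubeFinset (4 * l₂) y with hΓ
  set a : Site d → ℝ := fun k => T * σ * weight I (k - y) with ha
  have hTc : T * (c / 2) = 2 * ε := by rw [hT]; field_simp; norm_num
  have hT0 : 0 < T := by positivity
  have h1 := prodMeasure_close_le hμ hρi hρ hV (measurable_cubeEig u l₁ x)
    (measurable_cubeEig u l₂ y) Γ a hε (fun i ω => by
      have : ∀ z, localPotential u (cubeFinset (4 * l₁) x) (ω + ∑ k ∈ Γ, Pi.single k (a k)) z =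
          localPotential u (cubeFinset (4 * l₁) x) ω z := fun z => by
        refine Finset.sum_congr rfl fun k hk => ?_
        rw [Pi.add_apply, sum_single_apply, if_neg, add_zero]
        exact fun hk' => Set.disjoint_left.1 hdisj (mem_cubeFinset.1 hk) (mem_cubeFinset.1 hk')
      simp only [cubeEig, this])
    (fun j ω => eig_add_le _ (fun z => by
      have : localPotential u Γ (ω + ∑ k ∈ Γ, Pi.single k (a k)) z =
          localPotential u Γ ω z + T * (σ * ∑ k ∈ Γ, weight I (k - y) * u (z - k)) := by
        simp only [localPotential, Finset.mul_sum]
        rw [← Finset.sum_add_distrib]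
        refine Finset.sum_congr rfl fun k hk => ?_
        rw [Pi.add_apply, sum_single_apply, if_pos hk]
        ring
      rw [this, ← hTc]
      have := mul_le_mul_of_nonneg_left (hcov z z.2) hT0.le
      linarith) j)
  simp only [Fintype.card_fin] at h1
  set N := ∑ r, I r with hN
  set Q := 2 * max l₁ l₂ + 1 with hQ
  have hm1 := le_max_left l₁ l₂
  have hm2 := le_max_right l₁ l₂
  have hQ1 : 1 ≤ Q := by linarith
  have hsum : ∑ k ∈ Γ, |a k| ≤ (4 * Q) ^ d * (T * ((2 + N) * Q) ^ N) := by
    have hak : ∀ k ∈ Γ, |a k| ≤ T * ((2 + N) * Q) ^ N := fun k hk => by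
      rw [ha, abs_mul, abs_mul, abs_of_pos hT0]
      have hw : |weight I (k - y)| ≤ ((2 + N) * Q) ^ N := by
        refine (abs_weight_le I (t := 4 * l₂) fun r => ?_).trans ?_
        · simpa using mem_cubeFinset.1 hk r
        · rw [← hN]
          gcongr
          nlinarith [(N.cast_nonneg : (0 : ℝ) ≤ N)]
      calc T * |σ| * |weight I (k - y)| ≤ T * 1 * ((2 + N) * Q) ^ N := by gcongr
        _ = _ := by ring
    refine (Finset.sum_le_card_nsmul _ _ _ hak).trans ?_
    rw [nsmul_eq_mul]
    gcongr
    refine (card_cubeFinset_le (by positivity) y).trans ?_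
    gcongr
    linarith
  refine ENNReal.toReal_le_of_le_ofReal (by positivity)
    (h1.trans (ENNReal.ofReal_le_ofReal ?_))
  have hc1 : (Fintype.card (cube l₁ x) : ℝ) ≤ Q ^ d := by
    refine (card_cube_le hl₁.le x).trans ?_
    gcongr
    linarith
  have hc2 : (Fintype.card (cube l₂ y) : ℝ) ≤ Q ^ d := by
    refine (card_cube_le hl₂.le y).trans ?_
    gcongr
    linarith
  calc (Fintype.card (cube l₁ x) : ℝ) * Fintype.card (cube l₂ y) * V * ∑ k ∈ Γ, |a k|
      ≤ Q ^ d * Q ^ d * V * ((4 * Q) ^ d * (T * ((2 + N) * Q) ^ N)) := by gcongr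
    _ = _ := by
      rw [hT, mul_pow, mul_pow, pow_add, pow_mul']
      ring

end AlloyType

/-! ### The resonance estimate for two disjoint enlarged cubes -/

theorem proposition5p1 {d : ℕ} (u : AlloyType.Site d → ℝ) (C α : ℝ)
    (hu : AlloyType.ExpDecay u C α)
    (I₀ : Fin d → ℕ) (hI₀ : AlloyType.IsLeadingIndex u I₀) :
    ∃ l₀ : ℝ, ∀ (μ : Measure ℝ) [IsProbabilityMeasure μ] (ρ : ℝ → ℝ),
      Bornology.IsBounded μ.support → AlloyType.IsDensity μ ρ → AlloyType.IsBV ρ →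
      ∃ C₁ C₂ : ℝ, 0 < C₁ ∧
        ∀ (x y : AlloyType.Site d) (l₁ l₂ : ℝ), 0 < l₁ → 0 < l₂ →
          Disjoint (AlloyType.cube (4 * l₁) x) (AlloyType.cube (4 * l₂) y) → l₀ ≤ l₂ →
          ∀ ε : ℝ, 0 < ε →
            (AlloyType.prodMeasure d μ).real (AlloyType.resonanceEvent u μ x y l₁ l₂ ε)
              ≤ C₁ * (2 * max l₁ l₂ + 1) ^ (3 * d + ∑ r, I₀ r) *
                  (ε + C₂ * Real.exp (-(3 * min l₁ l₂ * α / 2))) := by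
  obtain ⟨l₀, hl₀⟩ := hI₀.exists_half_le hu
  refine ⟨l₀, fun μ _ ρ hbdd hμ hρ => ?_⟩
  obtain ⟨V, hV, hvar⟩ := hρ.exists_variationBound
  obtain ⟨R₀, hR₀⟩ := hbdd.subset_closedBall 0
  set R := |R₀| with hRdef
  have hR : ∀ t ∈ μ.support, |t| ≤ R := fun t ht => by
    have := hR₀ ht
    rw [mem_closedBall_zero_iff, Real.norm_eq_abs] at this
    exact this.trans (le_abs_self _)
  obtain ⟨hC, hα, -⟩ := id hu
  set S := AlloyType.expSum d (α / 2) with hS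
  have hS0 : 0 ≤ S := AlloyType.expSum_nonneg _ _
  set c := AlloyType.moment u I₀ with hc
  have hc0 : 0 < |c| := abs_pos.2 (hI₀.moment_ne_zero hu)
  -- Enlarging the variation bound by one makes `C₁` strictly positive.
  have hvar' : AlloyType.VariationBound ρ (V + 1) := fun φ M h1 h2 h3 =>
    (hvar φ M h1 h2 h3).trans (mul_le_mul_of_nonneg_left (by linarith)
      ((abs_nonneg _).trans (h3 0)))
  refine ⟨4 ^ d * (2 + ∑ r, I₀ r : ℝ) ^ (∑ r, I₀ r) * (4 / |c|) * (V + 1), 2 * (R * C * S),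
    by positivity, fun x y l₁ l₂ hl₁ hl₂ hdisj hl ε hε => ?_⟩
  -- The two truncation errors, one for each cube, are both estimated with the smaller radius.
  set ε' := ε + 2 * (R * C * S) * Real.exp (-(3 * min l₁ l₂ * α / 2)) with hε'
  have hε'0 : 0 < ε' := by positivity
  have hprob : IsProbabilityMeasure (AlloyType.prodMeasure d μ) := by
    rw [AlloyType.prodMeasure]; infer_instance
  have hsub : AlloyType.resonanceEvent u μ x y l₁ l₂ ε ⊆
      {ω | ∃ i j, |AlloyType.cubeEig u l₁ x i ω - AlloyType.cubeEig u l₂ y j ω| < ε'} := by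
    intro ω hω
    obtain ⟨i, j, hij⟩ := hu.exists_of_mem_resonanceEvent hR hω
    refine ⟨i, j, hij.trans_le ?_⟩
    have hexp : ∀ l, min l₁ l₂ ≤ l → R * C * Real.exp (-(3 * l * α / 2)) * S ≤
        R * C * S * Real.exp (-(3 * min l₁ l₂ * α / 2)) := fun l hle => by
      rw [mul_right_comm]
      gcongr
    have h1 := hexp l₁ (min_le_left _ _)
    have h2 := hexp l₂ (min_le_right _ _)
    linarith
  -- Monotonicity of the outer measure suffices here, so measurability of the resonance event itself
  -- is never needed.
  refine (measureReal_mono hsub).trans ?_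
  refine AlloyType.prodMeasure_cubeEig_close_le hμ hρ.1 hvar' (by positivity) hl₁ hl₂ hdisj I₀
    hc0 (σ := SignType.sign c) ?_ (fun z hz => hl₀ l₂ z y hl₂ hl hz) hε'0
  rcases lt_trichotomy c 0 with h | h | h <;> simp [h]
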